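/- Let $\mathfrak S_n$ be the set of permutations of $\{1,\dots,n\}$, written in one-line notation $\pi=\pi_1\pi_2\cdots\pi_n$; write $|\pi|=n$, and let $1$ also denote the permutation of size $1$. A permutation is $312$-avoiding if it has no subsequence order isomorphic to $312$. For permutations $\alpha,\beta$, possibly empty, of sizes $a,b$, let $12[\alpha,\beta]$ (respectively $21[\alpha,\beta]$) be the permutation of size $a+b$ whose first $a$ entries are the $a$ smallest (respectively largest) values, in the relative order of $\alpha$, and whose last $b$ entries are the $b$ largest (respectively smallest) values, in the relative order of $\beta$. A reduced word of $\pi\in\mathfrak S_n$ is a word $i_1i_2\cdots i_k$ in the letters $1,\dots,n-1$ with $\pi=s_{i_1}s_{i_2}\cdots s_{i_k}$ and $k$ minimal, where $s_i$ is the transposition of $i$ and $i+1$; this minimal $k$ is the length $\ell(\pi)$, and $R(\pi)$ is the set of reduced words of $\pi$. Let $G_\pi$ be the graph on $R(\pi)$ whose edges are the commutation moves (switching two adjacent letters $j,k$ with $|j-k|>1$) and the long braid moves (replacing consecutive letters $j\,(j+1)\,j$ by $(j+1)\,j\,(j+1)$, or conversely). Let $C_\pi$ (respectively $B_\pi$)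 be the simple graph obtained from $G_\pi$ by contracting all commutation edges (respectively all long braid edges). **Theorem.** Let $n\ge 1$, let $\pi\in\mathfrak S_n$ be $312$-avoiding, and let $m\in\{1,\dots,n\}$ be the index with $\pi_m=1$. Then $$\pi=12[21[\pi',1],\pi'']$$ for two $312$-avoiding permutations $\pi'$ and $\pi''$ with $|\pi'|=m-1$ and $|\pi''|=n-m$. The graphs $G_\sigma,C_\sigma,B_\sigma$ are connected for each $\sigma\in\{\pi,\pi',\pi''\}$, and their diameters satisfy 1. $\operatorname{diam}(G_\pi)=\operatorname{diam}(G_{\pi'})+\operatorname{diam}(G_{\pi''})+(m-1)(\ell(\pi')+\ell(\pi''))+\ell(\pi')(\ell(\pi'')-1)$, 2. $\operatorname{diam}(C_\pi)=\operatorname{diam}(C_{\pi'})+\operatorname{diam}(C_{\pi''})+\ell(\pi')$, 3. $\operatorname{diam}(B_\pi)=\operatorname{diam}(B_{\pi'})+\operatorname{diam}(B_{\pi''})+(m-1)(\ell(\pi')+\ell(\pi''))+\ell(\pi')(\ell(\pi'')-2)$. -/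

import Mathlib

/-! Permutations of size `n` are elements of `Equiv.Perm (Fin n)`.  Positions and values of a
permutation are `0, …, n - 1` here (so the value "1" of one-line notation is `0 : Fin n`), while
letters of words are the natural numbers `1, …, n - 1`. -/

namespace WordGraph

/-! ### Patterns and inflations -/

/-- `π` contains the pattern `σ`: some subsequence of `π` is order isomorphic to `σ`. -/
def Contains {k n : ℕ} (π : Equiv.Perm (Fin n)) (σ : Equiv.Perm (Fin k)) : Prop :=
  ∃ e : Fin k ↪o Fin n, ∀ i j : Fin k, π (e i) ≤ π (e j) ↔ σ i ≤ σ j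

/-- `π` avoids the pattern `σ`. -/
def Avoids {k n : ℕ} (π : Equiv.Perm (Fin n)) (σ : Equiv.Perm (Fin k)) : Prop :=
  ¬ Contains π σ

/-- The permutation `312`. -/
def perm312 : Equiv.Perm (Fin 3) where
  toFun := ![2, 0, 1]
  invFun := ![1, 2, 0]
  left_inv := by decide
  right_inv := by decide

/-- The inflation `12[α, β]`: the first `a` positions carry a copy of `α` on the `a` smallest
values, the last `b` positions a copy of `β` on the `b` largest values. -/
def inflate12 {a b : ℕ} (α : Equiv.Perm (Fin a)) (β : Equiv.Perm (Fin b)) :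
    Equiv.Perm (Fin (a + b)) :=
  (finSumFinEquiv.symm.trans (Equiv.sumCongr α β)).trans finSumFinEquiv

/-- The inflation `21[α, β]`: the first `a` positions carry a copy of `α` on the `a` largest
values, the last `b` positions a copy of `β` on the `b` smallest values. -/
def inflate21 {a b : ℕ} (α : Equiv.Perm (Fin a)) (β : Equiv.Perm (Fin b)) :
    Equiv.Perm (Fin (a + b)) :=
  (((finSumFinEquiv.symm.trans (Equiv.sumCongr α β)).trans (Equiv.sumComm _ _)).trans
    finSumFinEquiv).trans (finCongr (Nat.add_comm b a))

/-- The same permutation, regarded as a permutation of size `n` when its size is written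
differently. -/
def resize {k n : ℕ} (h : k = n) (π : Equiv.Perm (Fin k)) : Equiv.Perm (Fin n) :=
  (finCongr h).permCongr π

/-! ### Reduced words -/

/-- The simple reflection `s_i` of `𝔖_n`, `1 ≤ i ≤ n - 1`, which interchanges the `i`-th and the
`(i + 1)`-st element.  (The value for other `i` is never used.) -/
def simple (n i : ℕ) : Equiv.Perm (Fin n) :=
  if h : 1 ≤ i ∧ i < n then Equiv.swap ⟨i - 1, by omega⟩ ⟨i, h.2⟩ else 1

/-- The word `i₁ i₂ … i_k` has letters in `{1, …, n - 1}` and `π = s_{i₁} s_{i₂} ⋯ s_{i_k}`. -/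
def IsWord {n : ℕ} (π : Equiv.Perm (Fin n)) (w : List ℕ) : Prop :=
  (∀ i ∈ w, 1 ≤ i ∧ i < n) ∧ (w.map (simple n)).prod = π

/-- `w` is a reduced word of `π`: a word for `π` with the minimal number of letters. -/
def IsReducedWord {n : ℕ} (π : Equiv.Perm (Fin n)) (w : List ℕ) : Prop :=
  IsWord π w ∧ ∀ v : List ℕ, IsWord π v → w.length ≤ v.length

/-- The length `ℓ(π)`: the minimal number of letters of a word for `π`. -/
noncomputable def len {n : ℕ} (π : Equiv.Perm (Fin n)) : ℕ :=
  sInf {k : ℕ | ∃ w : List ℕ, IsWord π w ∧ w.length = k}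

/-- The set `R(π)` of reduced words of `π`. -/
def R {n : ℕ} (π : Equiv.Perm (Fin n)) : Set (List ℕ) :=
  {w | IsReducedWord π w}

/-! ### The graphs -/

/-- A commutation move: adjacent letters `j k` with `|j - k| > 1` are switched. -/
def CommMove (w v : List ℕ) : Prop :=
  ∃ (p q : List ℕ) (j k : ℕ), (j + 1 < k ∨ k + 1 < j) ∧
    w = p ++ [j, k] ++ q ∧ v = p ++ [k, j] ++ q

/-- A long braid move, from `j (j+1) j` to `(j+1) j (j+1)` on consecutive indices; the graph
below also uses it in the other direction. -/
def BraidMove (w v : List ℕ) : Prop :=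
  ∃ (p q : List ℕ) (j : ℕ),
    w = p ++ [j, j + 1, j] ++ q ∧ v = p ++ [j + 1, j, j + 1] ++ q

/-- The commutation edges on `R(π)`. -/
def commGraph {n : ℕ} (π : Equiv.Perm (Fin n)) : SimpleGraph (R π) :=
  SimpleGraph.fromRel fun w v => CommMove w.1 v.1

/-- The long braid edges on `R(π)`. -/
def braidGraph {n : ℕ} (π : Equiv.Perm (Fin n)) : SimpleGraph (R π) :=
  SimpleGraph.fromRel fun w v => BraidMove w.1 v.1

/-- The graph `G_π` on `R(π)`, whose edges are the commutation edges and the long braid edges. -/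
def G {n : ℕ} (π : Equiv.Perm (Fin n)) : SimpleGraph (R π) :=
  commGraph π ⊔ braidGraph π

/-- The graph `Γ` contracted along the edges of `H`: its vertices are the connected components
of `H`; two distinct ones are adjacent when `Γ` has an edge between them. -/
def contract {V : Type*} (Γ H : SimpleGraph V) : SimpleGraph H.ConnectedComponent where
  Adj c d := c ≠ d ∧ ∃ u v : V,
    H.connectedComponentMk u = c ∧ H.connectedComponentMk v = d ∧ Γ.Adj u v
  symm := ⟨fun _ _ ⟨h, u, v, hu, hv, huv⟩ => ⟨h.symm, v, u, hv, hu, huv.symm⟩⟩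
  loopless := ⟨fun _ h => h.1 rfl⟩

/-- `C_π`: the graph `G_π` contracted along the commutation edges. -/
def C {n : ℕ} (π : Equiv.Perm (Fin n)) : SimpleGraph (commGraph π).ConnectedComponent :=
  contract (G π) (commGraph π)

/-- `B_π`: the graph `G_π` contracted along the long braid edges. -/
def B {n : ℕ} (π : Equiv.Perm (Fin n)) : SimpleGraph (braidGraph π).ConnectedComponent :=
  contract (G π) (braidGraph π)

/-- `G_π`, `C_π` and `B_π` are connected, so that their diameters are the maximal distances. -/
def GraphsConnected {n : ℕ} (π : Equiv.Perm (Fin n)) : Prop :=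
  (G π).Connected ∧ (C π).Connected ∧ (B π).Connected

end WordGraph

/-
Give a long braid move the cost `θ` and a commutation move the cost `κ`.  The weights `(1, 1)`,
`(1, 0)` and `(0, 1)` turn the diameters of `G`, `C` and `B` into diameters of the set of reduced
words, so it suffices to see how the weighted diameter behaves under `π' ↦ 21[π', 1]` and under
`12[α, β]`.

In a reduced word of `21[π', 1]`, with `π'` of size `a`, the strand of the least value rises through
each height once.  Erasing it leaves a reduced word of `π'`; each remaining letter, by the time the
strand has passed from one side of it to the other, has taken part in one braid move and `a - 2`
commutation moves with the strand.  In a reduced word of `12[α, β]` the letters of `α` commute with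
those of `β`, and each pair of them can be switched.

Both upper bounds come from the same averaging.  Given two words, bring the strand to the front in
both (or the letters of `α`), carry out the moves of the smaller words, and put it back; or do the
same with the back.  A letter is passed by the strand in exactly one of the two ways to treat each
of the words, so the costs of the two paths add up to twice the asserted diameter.  For the lower
bound, take words at maximal distance and place the strand at the front of one and at the back of
the other.
-/

namespace WordGraph

section Moves

variable {w v u : List ℕ} {t c t' c' : ℕ}

theorem CommMove.symm (h : CommMove w v) : CommMove v w := by
  obtain ⟨p, q, j, k, hjk, rfl, rfl⟩ := h
  exact ⟨p, q, k, j, hjk.symm, rfl, rfl⟩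

theorem CommMove.ne (h : CommMove w v) : w ≠ v := by
  obtain ⟨p, q, j, k, hjk, rfl, rfl⟩ := h
  rw [Ne, List.append_left_inj, List.append_right_inj]
  grind

theorem BraidMove.ne (h : BraidMove w v) : w ≠ v := by
  obtain ⟨p, q, j, rfl, rfl⟩ := h
  simp

theorem CommMove.mem_iff (h : CommMove w v) (x : ℕ) : x ∈ w ↔ x ∈ v := by
  obtain ⟨p, q, j, k, -, rfl, rfl⟩ := h
  grind

theorem BraidMove.mem_iff (h : BraidMove w v) (x : ℕ) : x ∈ w ↔ x ∈ v := by
  obtain ⟨p, q, j, rfl, rfl⟩ := h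
  grind

theorem CommMove.append_left (l : List ℕ) (h : CommMove w v) : CommMove (l ++ w) (l ++ v) := by
  obtain ⟨p, q, j, k, hjk, rfl, rfl⟩ := h
  exact ⟨l ++ p, q, j, k, hjk, by simp, by simp⟩

theorem CommMove.append_right (l : List ℕ) (h : CommMove w v) : CommMove (w ++ l) (v ++ l) := by
  obtain ⟨p, q, j, k, hjk, rfl, rfl⟩ := h
  exact ⟨p, q ++ l, j, k, hjk, by simp, by simp⟩

theorem BraidMove.append_left (l : List ℕ) (h : BraidMove w v) : BraidMove (l ++ w) (l ++ v) := by
  obtain ⟨p, q, j, rfl, rfl⟩ := h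
  exact ⟨l ++ p, q, j, by simp, by simp⟩

theorem BraidMove.append_right (l : List ℕ) (h : BraidMove w v) :
    BraidMove (w ++ l) (v ++ l) := by
  obtain ⟨p, q, j, rfl, rfl⟩ := h
  exact ⟨p, q ++ l, j, by simp, by simp⟩

/-- The word `w` with all letters raised by `d`. -/
def shift (d : ℕ) (w : List ℕ) : List ℕ := w.map (· + d)

@[simp] theorem shift_nil (d : ℕ) : shift d [] = [] := rfl

@[simp] theorem shift_cons (d x : ℕ) (w : List ℕ) : shift d (x :: w) = (x + d) :: shift d w := rfl

@[simp] theorem shift_append (d : ℕ) (w v : List ℕ) :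
    shift d (w ++ v) = shift d w ++ shift d v :=
  List.map_append

@[simp] theorem length_shift (d : ℕ) (w : List ℕ) : (shift d w).length = w.length :=
  List.length_map _

theorem mem_shift {d x : ℕ} : x ∈ shift d w ↔ ∃ y ∈ w, y + d = x :=
  List.mem_map

theorem CommMove.shift (d : ℕ) (h : CommMove w v) :
    CommMove (WordGraph.shift d w) (WordGraph.shift d v) := by
  obtain ⟨p, q, j, k, hjk, rfl, rfl⟩ := h
  exact ⟨WordGraph.shift d p, WordGraph.shift d q, j + d, k + d, by omega, by simp, by simp⟩

theorem BraidMove.shift (d : ℕ) (h : BraidMove w v) :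
    BraidMove (WordGraph.shift d w) (WordGraph.shift d v) := by
  obtain ⟨p, q, j, rfl, rfl⟩ := h
  exact ⟨WordGraph.shift d p, WordGraph.shift d q, j + d,
    by simp [add_right_comm], by simp [add_right_comm]⟩

/-- `MovePath w v t c`: the word `v` is obtained from `w` by `t` long braid moves, in either
direction, and `c` commutation moves. -/
inductive MovePath : List ℕ → List ℕ → ℕ → ℕ → Prop
  | refl (w : List ℕ) : MovePath w w 0 0
  | comm {w v u : List ℕ} {t c : ℕ} :
      CommMove w v → MovePath v u t c → MovePath w u t (c + 1)
  | braid {w v u : List ℕ} {t c : ℕ} :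
      BraidMove w v ∨ BraidMove v w → MovePath v u t c → MovePath w u (t + 1) c

namespace MovePath

theorem cast (h : MovePath w v t c) (ht : t = t') (hc : c = c') : MovePath w v t' c' := by
  subst ht hc
  exact h

theorem of_comm (h : CommMove w v) : MovePath w v 0 1 := .comm h (.refl v)

theorem of_braid (h : BraidMove w v ∨ BraidMove v w) : MovePath w v 1 0 := .braid h (.refl v)

theorem trans (h : MovePath w v t c) (h' : MovePath v u t' c') :
    MovePath w u (t + t') (c + c') := by
  induction h with
  | refl => exact h'.cast (zero_add _).symm (zero_add _).symm
  | comm h _ ih => exact (comm h (ih h')).cast rfl (by omega)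
  | braid h _ ih => exact (braid h (ih h')).cast (by omega) rfl

theorem symm (h : MovePath w v t c) : MovePath v w t c := by
  induction h with
  | refl => exact refl _
  | comm h _ ih => exact ih.trans (of_comm h.symm)
  | braid h _ ih => exact ih.trans (of_braid h.symm)

theorem append_left (l : List ℕ) (h : MovePath w v t c) : MovePath (l ++ w) (l ++ v) t c := by
  induction h with
  | refl => exact refl _
  | comm h _ ih => exact comm (h.append_left l) ih
  | braid h _ ih => exact braid (h.imp (·.append_left l) (·.append_left l)) ih

theorem append_right (l : List ℕ) (h : MovePath w v t c) : MovePath (w ++ l) (v ++ l) t c := by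
  induction h with
  | refl => exact refl _
  | comm h _ ih => exact comm (h.append_right l) ih
  | braid h _ ih => exact braid (h.imp (·.append_right l) (·.append_right l)) ih

theorem cons (x : ℕ) (h : MovePath w v t c) : MovePath (x :: w) (x :: v) t c :=
  h.append_left [x]

theorem mem_iff (h : MovePath w v t c) (x : ℕ) : x ∈ w ↔ x ∈ v := by
  induction h with
  | refl => rfl
  | comm h _ ih => exact (h.mem_iff x).trans ih
  | braid h _ ih => exact (h.elim (·.mem_iff x) fun h => (h.mem_iff x).symm).trans ih

theorem shift (d : ℕ) (h : MovePath w v t c) :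
    MovePath (WordGraph.shift d w) (WordGraph.shift d v) t c := by
  induction h with
  | refl => exact refl _
  | comm h _ ih => exact comm (h.shift d) ih
  | braid h _ ih => exact braid (h.imp (·.shift d) (·.shift d)) ih

theorem cons_concat {x : ℕ} {l : List ℕ} (h : ∀ y ∈ l, x + 1 < y ∨ y + 1 < x) :
    MovePath (x :: l) (l ++ [x]) 0 l.length := by
  induction l with
  | nil => exact refl _
  | cons y l ih =>
    rw [List.forall_mem_cons] at h
    exact comm ⟨[], l, x, y, h.1, rfl, rfl⟩ ((ih h.2).cons y)

end MovePath

/-- `Within θ κ N w v`: some path of moves from `w` to `v` costs at most `N`, when a long braid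
move costs `θ` and a commutation move costs `κ`.  The weights `(1, 1)`, `(1, 0)` and `(0, 1)`
measure distances in `G`, `C` and `B`. -/
def Within (θ κ N : ℕ) (w v : List ℕ) : Prop :=
  ∃ t c, MovePath w v t c ∧ θ * t + κ * c ≤ N

namespace Within

variable {θ κ N N' T D : ℕ}

theorem symm (h : Within θ κ N w v) : Within θ κ N v w :=
  let ⟨t, c, p, hN⟩ := h
  ⟨t, c, p.symm, hN⟩

theorem trans (h : Within θ κ N w v) (h' : Within θ κ N' v u) : Within θ κ (N + N') w u := by
  obtain ⟨t, c, p, hN⟩ := h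
  obtain ⟨t', c', p', hN'⟩ := h'
  exact ⟨_, _, p.trans p', by linarith⟩

theorem mono (h : Within θ κ N w v) (hN : N ≤ N') : Within θ κ N' w v :=
  let ⟨t, c, p, hp⟩ := h
  ⟨t, c, p, hp.trans hN⟩

/-- Of two paths, the cheaper one costs at most the average, whatever the weights. -/
theorem of_add_eq_two_mul (p : MovePath w v t c) (p' : MovePath w v t' c')
    (ht : t + t' = 2 * T) (hc : c + c' = 2 * D) : Within θ κ (θ * T + κ * D) w v := by
  have hsum : (θ * t + κ * c) + (θ * t' + κ * c') = 2 * (θ * T + κ * D) := by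
    linear_combination θ * ht + κ * hc
  rcases le_total (θ * t + κ * c) (θ * t' + κ * c') with h | h
  · exact ⟨t, c, p, by omega⟩
  · exact ⟨t', c', p', by omega⟩

end Within

end Moves

section Words

variable {n : ℕ} {π : Equiv.Perm (Fin n)} {w v : List ℕ}

/-- The simple reflection of letter `x` on all of `ℕ`, so that words act on positions without
reference to a size.  For `x = 0` it is the identity. -/
def natSimple (x : ℕ) : Equiv.Perm ℕ := Equiv.swap (x - 1) x

/-- The permutation of `ℕ` represented by a word. -/
def natProd (w : List ℕ) : Equiv.Perm ℕ := (w.map natSimple).prod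

@[simp] theorem natProd_nil : natProd [] = 1 := rfl

@[simp] theorem natProd_cons (x : ℕ) (w : List ℕ) :
    natProd (x :: w) = natSimple x * natProd w :=
  List.prod_cons

@[simp] theorem natProd_append (v w : List ℕ) : natProd (v ++ w) = natProd v * natProd w := by
  simp [natProd]

theorem natSimple_apply (x y : ℕ) :
    natSimple x y = if y = x - 1 then x else if y = x then x - 1 else y :=
  Equiv.swap_apply_def _ _ _

theorem natSimple_val {x : ℕ} (hx : 1 ≤ x ∧ x < n) (j : Fin n) :
    natSimple x j = (simple n x j : ℕ) := by
  rw [natSimple_apply, simple, dif_pos hx, Equiv.swap_apply_def]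
  simp only [Fin.ext_iff]
  split_ifs <;> rfl

theorem natProd_val (hw : ∀ x ∈ w, 1 ≤ x ∧ x < n) (j : Fin n) :
    natProd w j = ((w.map (simple n)).prod j : ℕ) := by
  induction w with
  | nil => rfl
  | cons x w ih =>
    rw [List.forall_mem_cons] at hw
    simp only [natProd_cons, Equiv.Perm.mul_apply, List.map_cons, List.prod_cons, ih hw.2,
      natSimple_val hw.1]

theorem isWord_iff :
    IsWord π w ↔ (∀ x ∈ w, 1 ≤ x ∧ x < n) ∧ ∀ j : Fin n, natProd w j = (π j : ℕ) := by
  refine and_congr_right fun hw => ?_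
  simp only [Equiv.ext_iff, Fin.ext_iff, natProd_val hw]

theorem IsWord.one_le (hw : IsWord π w) : ∀ x ∈ w, 1 ≤ x := fun x hx => (hw.1 x hx).1

theorem IsWord.lt (hw : IsWord π w) : ∀ x ∈ w, x < n := fun x hx => (hw.1 x hx).2

theorem length_eq_len (hw : w ∈ R π) : w.length = len π :=
  le_antisymm (le_csInf ⟨_, w, hw.1, rfl⟩ fun _ ⟨v, hv, hk⟩ => hk ▸ hw.2 v hv)
    (Nat.sInf_le ⟨w, hw.1, rfl⟩)

theorem len_le_length (hw : IsWord π w) : len π ≤ w.length :=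
  Nat.sInf_le ⟨w, hw, rfl⟩

theorem mem_R_iff : w ∈ R π ↔ IsWord π w ∧ w.length ≤ len π :=
  ⟨fun hw => ⟨hw.1, (length_eq_len hw).le⟩,
    fun hw => ⟨hw.1, fun _ hv => hw.2.trans (len_le_length hv)⟩⟩

theorem IsWord.exists_mem_R (hw : IsWord π w) : ∃ v, v ∈ R π := by
  obtain ⟨v, hv, hlen⟩ := Nat.sInf_mem (s := {k | ∃ v, IsWord π v ∧ v.length = k}) ⟨_, w, hw, rfl⟩
  exact ⟨v, mem_R_iff.2 ⟨hv, hlen.le⟩⟩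

theorem finite_R (π : Equiv.Perm (Fin n)) : (R π).Finite := by
  refine ((List.finite_length_eq (Fin n) (len π)).image (List.map Fin.val)).subset fun w hw => ?_
  lift w to List (Fin n) using hw.1.lt
  exact ⟨w, by simpa using length_eq_len hw, rfl⟩

theorem natSimple_mul_comm {j k : ℕ} (hj : 1 ≤ j) (hk : 1 ≤ k) (hjk : j + 1 < k ∨ k + 1 < j) :
    natSimple j * natSimple k = natSimple k * natSimple j :=
  (Equiv.Perm.Disjoint.commute fun y => by simp only [natSimple_apply]; split_ifs <;> omega).eq

theorem natSimple_braid {j : ℕ} (hj : 1 ≤ j) :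
    natSimple j * (natSimple (j + 1) * natSimple j) =
      natSimple (j + 1) * (natSimple j * natSimple (j + 1)) := by
  ext y
  simp only [Equiv.Perm.mul_apply, natSimple_apply]
  grind

theorem CommMove.natProd_eq (h : CommMove w v) (hw : ∀ x ∈ w, 1 ≤ x) :
    natProd w = natProd v := by
  obtain ⟨p, q, j, k, hjk, rfl, rfl⟩ := h
  simp only [natProd_append, natProd_cons, natProd_nil, mul_one,
    natSimple_mul_comm (hw j (by simp)) (hw k (by simp)) hjk]

theorem BraidMove.natProd_eq (h : BraidMove w v) (hw : ∀ x ∈ w, 1 ≤ x) :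
    natProd w = natProd v := by
  obtain ⟨p, q, j, rfl, rfl⟩ := h
  simp only [natProd_append, natProd_cons, natProd_nil, mul_one,
    natSimple_braid (hw j (by simp))]

theorem mem_R_congr (hmem : ∀ x, x ∈ w ↔ x ∈ v) (hlen : w.length = v.length)
    (hprod : (∀ x ∈ w, 1 ≤ x) → natProd w = natProd v) : w ∈ R π ↔ v ∈ R π := by
  rw [mem_R_iff, mem_R_iff, isWord_iff, isWord_iff, hlen]
  simp only [← hmem]
  exact and_congr_left' (and_congr_right fun hw => by rw [hprod fun x hx => (hw x hx).1])

theorem CommMove.mem_R_iff (h : CommMove w v) : w ∈ R π ↔ v ∈ R π := by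
  refine mem_R_congr h.mem_iff ?_ h.natProd_eq
  obtain ⟨p, q, j, k, -, rfl, rfl⟩ := h
  simp

theorem BraidMove.mem_R_iff (h : BraidMove w v) : w ∈ R π ↔ v ∈ R π := by
  refine mem_R_congr h.mem_iff ?_ h.natProd_eq
  obtain ⟨p, q, j, rfl, rfl⟩ := h
  simp

end Words

section Strand

variable {k i n : ℕ} {w : List ℕ}

/-- The final position of the strand of the wiring diagram of `w` that starts at position `i`,
the letters of `w` being read from left to right. -/
def strandEnd : ℕ → List ℕ → ℕ
  | i, [] => i
  | i, x :: w =>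
    if x = i + 1 then strandEnd (i + 1) w
    else if x = i then strandEnd (i - 1) w
    else strandEnd i w

/-- The word whose wiring diagram is that of `w` without the strand that starts at position `i`:
the letters of the strand are dropped, those to its right are lowered by one. -/
def eraseStrand : ℕ → List ℕ → List ℕ
  | _, [] => []
  | i, x :: w =>
    if x = i + 1 then eraseStrand (i + 1) w
    else if x = i then eraseStrand (i - 1) w
    else (if x < i then x else x - 1) :: eraseStrand i w

/-- The number of letters of `w` to the right of the strand that starts at position `i`.  If that
strand rises, each of them needs one long braid move to get past its remaining letters. -/
def strandBraids : ℕ → List ℕ → ℕ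
  | _, [] => 0
  | i, x :: w =>
    if x = i + 1 then strandBraids (i + 1) w
    else if x = i then strandBraids (i - 1) w
    else (if x < i then 0 else 1) + strandBraids i w

/-- The number of commutation moves that bring the letters of a strand rising from position `i` to
position `k` to the front of `w`: at position `i` it has `k - i` letters left, two of which are
used up by a long braid move if the letter to be passed is to the right of the strand. -/
def strandComms (k : ℕ) : ℕ → List ℕ → ℕ
  | _, [] => 0
  | i, x :: w =>
    if x = i + 1 then strandComms k (i + 1) w
    else if x = i then strandComms k (i - 1) w
    else (if x < i then k - i else k - i - 2) + strandComms k i w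

/-- The strand of `w` that starts at position `i` moves to the right only, and ends at `k`. -/
def Rises (k : ℕ) : ℕ → List ℕ → Prop
  | i, [] => i = k
  | i, x :: w => if x = i + 1 then Rises k (i + 1) w else x ≠ i ∧ Rises k i w

theorem Rises.le (h : Rises k i w) : i ≤ k := by
  induction w generalizing i with
  | nil => exact le_of_eq h
  | cons x w ih =>
    simp only [Rises] at h
    split_ifs at h
    · exact (Nat.le_succ i).trans (ih h)
    · exact ih h.2

theorem strandEnd_append (i : ℕ) (p r : List ℕ) :
    strandEnd i (p ++ r) = strandEnd (strandEnd i p) r := by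
  induction p generalizing i with
  | nil => rfl
  | cons x p ih =>
    simp only [List.cons_append, strandEnd]
    split_ifs <;> exact ih _

theorem eraseStrand_append (i : ℕ) (p r : List ℕ) :
    eraseStrand i (p ++ r) = eraseStrand i p ++ eraseStrand (strandEnd i p) r := by
  induction p generalizing i with
  | nil => rfl
  | cons x p ih =>
    simp only [List.cons_append, eraseStrand, strandEnd]
    split_ifs <;> simp [ih]

theorem strandBraids_append (i : ℕ) (p r : List ℕ) :
    strandBraids i (p ++ r) = strandBraids i p + strandBraids (strandEnd i p) r := by
  induction p generalizing i with
  | nil => simp [strandBraids, strandEnd]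
  | cons x p ih =>
    simp only [List.cons_append, strandBraids, strandEnd]
    split_ifs <;> simp [ih, add_assoc]

theorem strandComms_append (k i : ℕ) (p r : List ℕ) :
    strandComms k i (p ++ r) = strandComms k i p + strandComms k (strandEnd i p) r := by
  induction p generalizing i with
  | nil => simp [strandComms, strandEnd]
  | cons x p ih =>
    simp only [List.cons_append, strandComms, strandEnd]
    split_ifs <;> simp [ih, add_assoc]

theorem Rises.of_append {p r : List ℕ} (h : Rises k i (p ++ r)) : Rises k (strandEnd i p) r := by
  induction p generalizing i with
  | nil => exact h
  | cons x p ih =>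
    simp only [List.cons_append, Rises, strandEnd] at h ⊢
    split_ifs at h ⊢ with h1 h2
    · exact ih h
    · exact absurd h2 h.1
    · exact ih h.2

theorem eraseStrand_bounds (hi : i ≤ n) (hw : ∀ x ∈ w, 1 ≤ x ∧ x < n + 1) :
    ∀ y ∈ eraseStrand i w, 1 ≤ y ∧ y < n := by
  induction w generalizing i with
  | nil => simp [eraseStrand]
  | cons x w ih =>
    rw [List.forall_mem_cons] at hw
    simp only [eraseStrand]
    split_ifs with h1 h2 h3
    · exact ih (by omega) hw.2
    · exact ih (by omega) hw.2
    all_goals exact List.forall_mem_cons.2 ⟨by omega, ih hi hw.2⟩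

theorem strandEnd_add_length_eraseStrand_le (i : ℕ) (w : List ℕ) :
    strandEnd i w + (eraseStrand i w).length ≤ i + w.length := by
  induction w generalizing i with
  | nil => rfl
  | cons x w ih =>
    simp only [strandEnd, eraseStrand, List.length_cons]
    split_ifs
    · linarith [ih (i + 1)]
    · have := ih (i - 1)
      omega
    all_goals
      rw [List.length_cons]
      linarith [ih i]

/-- A strand rises exactly when it uses as few letters as its two ends allow. -/
theorem rises_iff : Rises k i w ↔
    strandEnd i w = k ∧ i + w.length = k + (eraseStrand i w).length := by
  induction w generalizing i with
  | nil => simp [Rises, strandEnd, eraseStrand]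
  | cons x w ih =>
    simp only [Rises, strandEnd, eraseStrand, List.length_cons]
    split_ifs with h1 h2
    · rw [ih, add_right_comm, add_assoc]
    · have := strandEnd_add_length_eraseStrand_le (i - 1) w
      simp only [ne_eq, h2, not_true_eq_false, false_and, false_iff]
      omega
    all_goals
      simp only [ne_eq, h2, not_false_eq_true, true_and, ih, List.length_cons]
      omega

/-- The increasing map from `ℕ` to `ℕ` that omits the value `i` only. -/
def skip (i y : ℕ) : ℕ := if y < i then y else y + 1

theorem natProd_strandEnd (i : ℕ) (hw : ∀ x ∈ w, 1 ≤ x) : natProd w (strandEnd i w) = i := by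
  induction w generalizing i with
  | nil => rfl
  | cons x w ih =>
    rw [List.forall_mem_cons] at hw
    simp only [strandEnd, natProd_cons, Equiv.Perm.mul_apply]
    split_ifs <;> rw [ih _ hw.2, natSimple_apply] <;> grind

theorem natProd_skip_strandEnd (i : ℕ) (hw : ∀ x ∈ w, 1 ≤ x) (y : ℕ) :
    natProd w (skip (strandEnd i w) y) = skip i (natProd (eraseStrand i w) y) := by
  induction w generalizing i with
  | nil => rfl
  | cons x w ih =>
    rw [List.forall_mem_cons] at hw
    simp only [strandEnd, eraseStrand, natProd_cons, Equiv.Perm.mul_apply]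
    split_ifs <;> rw [ih _ hw.2]
    all_goals
      simp only [natProd_cons, Equiv.Perm.mul_apply, natSimple_apply]
      simp only [skip]
      split_ifs <;> omega

theorem movePath_cons_range' {x : ℕ} (h : i + 1 < x) (hk : x ≤ k) :
    MovePath (x :: List.range' (i + 1) (k - i)) (List.range' (i + 1) (k - i) ++ [x - 1]) 1
      (k - i - 2) := by
  obtain ⟨d, rfl⟩ : ∃ d, x = i + d + 2 := ⟨x - i - 2, by omega⟩
  obtain ⟨e, rfl⟩ : ∃ e, k = i + d + 2 + e := ⟨k - (i + d + 2), by omega⟩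
  set l := List.range' (i + 1) d with hl
  set r := List.range' (i + d + 3) e with hr
  have hsplit : List.range' (i + 1) (i + d + 2 + e - i) =
      l ++ ([i + d + 1, i + d + 2] ++ r) := by
    rw [show i + d + 2 + e - i = d + (2 + e) by omega, ← List.range'_append_1,
      ← List.range'_append_1, show i + 1 + d = i + d + 1 by omega]
    simp [List.range'_succ, hr, hl]
  have past_l : MovePath ((i + d + 2) :: l) (l ++ [i + d + 2]) 0 d := by
    simpa [hl] using MovePath.cons_concat (l := l) fun y hy => by
      rw [hl, List.mem_range'_1] at hy
      omega
  have braid : MovePath [i + d + 2, i + d + 1, i + d + 2] [i + d + 1, i + d + 2, i + d + 1] 1 0 :=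
    .of_braid (.inr ⟨[], [], i + d + 1, rfl, rfl⟩)
  have past_r : MovePath ((i + d + 1) :: r) (r ++ [i + d + 1]) 0 e := by
    simpa [hr] using MovePath.cons_concat (l := r) fun y hy => by
      rw [hr, List.mem_range'_1] at hy
      omega
  have p₁ := past_l.append_right ([i + d + 1, i + d + 2] ++ r)
  have p₂ := (braid.append_right r).append_left l
  have p₃ := past_r.append_left (l ++ [i + d + 1, i + d + 2])
  rw [hsplit]
  simp only [List.append_assoc, List.cons_append, List.nil_append] at p₁ p₂ p₃ ⊢
  exact ((p₁.trans p₂).trans p₃).cast (by omega) (by omega)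

theorem Rises.movePath_front (h : Rises k i w) (hw : ∀ x ∈ w, x ≤ k) :
    MovePath w (List.range' (i + 1) (k - i) ++ eraseStrand i w)
      (strandBraids i w) (strandComms k i w) := by
  induction w generalizing i with
  | nil =>
    obtain rfl : i = k := h
    simpa [eraseStrand, strandBraids, strandComms] using MovePath.refl []
  | cons x w ih =>
    rw [List.forall_mem_cons] at hw
    simp only [Rises] at h
    simp only [eraseStrand, strandBraids, strandComms]
    split_ifs at h ⊢ with h1 h2 h3
    · rw [show k - i = (k - (i + 1)) + 1 by have := h.le; omega, List.range'_succ, h1]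
      exact (ih h hw.2).cons (i + 1)
    · exact absurd h2 h.1
    · have past := MovePath.cons_concat (x := x) (l := List.range' (i + 1) (k - i)) fun y hy => by
        rw [List.mem_range'_1] at hy
        omega
      rw [List.length_range'] at past
      simpa using (((ih h.2 hw.2).cons x).trans (past.append_right _)).cast
        (add_comm _ _) (add_comm _ _)
    · have past := movePath_cons_range' (i := i) (by omega) hw.1
      simpa using (((ih h.2 hw.2).cons x).trans (past.append_right _)).cast
        (add_comm _ _) (add_comm _ _)

theorem Rises.exists_movePath_back (h : Rises k i w) (hw : ∀ x ∈ w, 1 ≤ x) :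
    ∃ t c, MovePath (List.range' 1 i ++ w) (shift 1 (eraseStrand i w) ++ List.range' 1 k) t c ∧
      strandBraids i w + t = (eraseStrand i w).length ∧
      ((∀ x ∈ w, x ≤ k) → strandComms k i w + c = (k - 2) * (eraseStrand i w).length) := by
  induction w generalizing i with
  | nil =>
    obtain rfl : i = k := h
    exact ⟨0, 0, by simpa [eraseStrand] using MovePath.refl _, rfl, fun _ => by
      simp [strandComms, eraseStrand]⟩
  | cons x w ih =>
    rw [List.forall_mem_cons] at hw
    simp only [Rises] at h
    simp only [eraseStrand, strandBraids, strandComms, List.forall_mem_cons]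
    split_ifs at h ⊢ with h1 h2 h3
    · obtain ⟨t, c, p, ht, hc⟩ := ih h hw.2
      refine ⟨t, c, ?_, ht, fun hk => hc hk.2⟩
      have hsplit : List.range' 1 (i + 1) ++ w = List.range' 1 i ++ x :: w := by
        rw [← List.range'_append_1, h1, add_comm 1 i]
        simp
      rwa [← hsplit]
    · exact absurd h2 h.1
    · obtain ⟨t, c, p, ht, hc⟩ := ih h.2 hw.2
      have past := (movePath_cons_range' (i := 0) (k := i) (x := x + 1) (by omega) h3).symm
      refine ⟨1 + t, i - 2 + c, ?_, ?_, fun hk => ?_⟩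
      · simpa using (past.append_right w).trans (p.cons (x + 1))
      · rw [List.length_cons]
        omega
      · have := hc hk.2
        have := h.2.le
        rw [List.length_cons, Nat.mul_succ]
        omega
    · obtain ⟨t, c, p, ht, hc⟩ := ih h.2 hw.2
      have past := (MovePath.cons_concat (x := x) (l := List.range' 1 i) fun y hy => by
        rw [List.mem_range'_1] at hy
        omega).symm
      refine ⟨t, i + c, ?_, ?_, fun hk => ?_⟩
      · simpa [Nat.sub_add_cancel hw.1] using (past.append_right w).trans (p.cons x)
      · rw [List.length_cons]
        omega
      · have := hc hk.2
        rw [List.length_cons, Nat.mul_succ]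
        omega

end Strand

section StrandMoves

variable {k i : ℕ} {w v : List ℕ}

theorem CommMove.eraseStrand (h : CommMove w v) (hw : Rises k i w) :
    strandBraids i v = strandBraids i w ∧
      ∃ c, MovePath (eraseStrand i w) (eraseStrand i v) 0 c ∧
        strandComms k i v + c ≤ strandComms k i w + 1 := by
  obtain ⟨p, q, j, l, hjl, rfl, rfl⟩ := h
  rw [List.append_assoc] at hw
  have hr := hw.of_append
  simp only [List.append_assoc, List.cons_append, List.nil_append]
  simp only [eraseStrand_append, strandBraids_append, strandComms_append]
  generalize strandEnd i p = s at hr ⊢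
  generalize WordGraph.eraseStrand i p = p'
  simp only [List.cons_append, List.nil_append, Rises] at hr
  simp only [WordGraph.eraseStrand, strandBraids, strandComms]
  by_cases hj : j = s + 1
  · have hl : l ≠ s + 1 + 1 := by omega
    have hl' : l ≠ s := by omega
    simp only [hj, if_true, hl, if_false] at hr
    have hlt : l < s + 1 ↔ l < s := by omega
    have := hr.2.le
    simp only [hj, hl, hl', hr.1, hlt, if_true, if_false]
    exact ⟨trivial, 0, .refl _, by split_ifs <;> omega⟩
  by_cases hl : l = s + 1
  · have hj' : j ≠ s + 1 + 1 := by omega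
    simp only [hj, if_false, hl, if_true] at hr
    have hlt : j < s + 1 ↔ j < s := by omega
    have := hr.2.le
    simp only [hj, hl, hr.1, hj', hlt, if_true, if_false]
    exact ⟨trivial, 0, .refl _, by split_ifs <;> omega⟩
  · simp only [hj, hl, if_false] at hr
    simp only [hj, hl, hr.1, hr.2.1, if_false]
    refine ⟨by omega, 1, .of_comm ⟨p', WordGraph.eraseStrand s q, if j < s then j else j - 1,
      if l < s then l else l - 1, ?_, by simp, by simp⟩, by omega⟩
    split_ifs <;> omega

theorem BraidMove.eraseStrand (h : BraidMove w v) (hw : Rises k i w) :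
    strandComms k i v = strandComms k i w ∧
      (BraidMove (eraseStrand i w) (eraseStrand i v) ∧ strandBraids i v = strandBraids i w ∨
        eraseStrand i v = eraseStrand i w ∧ strandBraids i v = strandBraids i w + 1) := by
  obtain ⟨p, q, j, rfl, rfl⟩ := h
  rw [List.append_assoc] at hw
  have hr := hw.of_append
  simp only [List.append_assoc, List.cons_append, List.nil_append]
  simp only [eraseStrand_append, strandBraids_append, strandComms_append]
  generalize strandEnd i p = s at hr ⊢
  generalize WordGraph.eraseStrand i p = p'
  simp only [List.cons_append, List.nil_append, Rises] at hr
  simp only [WordGraph.eraseStrand, strandBraids, strandComms]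
  by_cases hj : j = s + 1
  · subst hj
    grind
  · have hj' : j + 1 ≠ s + 1 := by grind
    simp only [hj, hj', if_false] at hr
    simp only [hj, hr.1, hj', hr.2.1, if_false]
    by_cases hlt : j < s
    · have hlt' : j + 1 < s := by omega
      simp only [hlt, hlt', if_true, true_and]
      exact .inl ⟨⟨p', WordGraph.eraseStrand s q, j, by simp, by simp⟩, trivial⟩
    · have hlt' : ¬ j + 1 < s := by omega
      simp only [hlt, hlt', if_false, true_and]
      exact .inl ⟨⟨p', WordGraph.eraseStrand s q, j - 1, by grind, by grind⟩, trivial⟩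

theorem MovePath.eraseStrand {t c : ℕ} (h : MovePath w v t c)
    (hw : ∀ u t c, MovePath w u t c → Rises k i u) :
    ∃ t' c', MovePath (eraseStrand i w) (eraseStrand i v) t' c' ∧
      strandBraids i v + t' ≤ strandBraids i w + t ∧
      strandComms k i v + c' ≤ strandComms k i w + c := by
  induction h with
  | refl => exact ⟨0, 0, .refl _, le_rfl, le_rfl⟩
  | comm h _ ih =>
    obtain ⟨hb, c₀, p₀, hc₀⟩ := h.eraseStrand (hw _ _ _ (.refl _))
    obtain ⟨t', c', p, ht', hc'⟩ := ih fun u t c p => hw u _ _ (.comm h p)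
    exact ⟨_, _, p₀.trans p, by omega, by omega⟩
  | braid h _ ih =>
    obtain ⟨t', c', p, ht', hc'⟩ := ih fun u t c p => hw u _ _ (.braid h p)
    rcases h with h | h
    · obtain ⟨hc, ⟨hb, hbr⟩ | ⟨he, hbr⟩⟩ := h.eraseStrand (hw _ _ _ (.refl _))
      · exact ⟨_, _, .braid (.inl hb) p, by omega, by omega⟩
      · exact ⟨_, _, he ▸ p, by omega, by omega⟩
    · obtain ⟨hc, ⟨hb, hbr⟩ | ⟨he, hbr⟩⟩ := h.eraseStrand (hw _ _ _ (.of_braid (.inr h)))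
      · exact ⟨_, _, .braid (.inr hb) p, by omega, by omega⟩
      · exact ⟨_, _, he ▸ p, by omega, by omega⟩

theorem strand_range' (k i d : ℕ) :
    strandEnd i (List.range' (i + 1) d) = i + d ∧
      WordGraph.eraseStrand i (List.range' (i + 1) d) = [] ∧
      strandBraids i (List.range' (i + 1) d) = 0 ∧
      strandComms k i (List.range' (i + 1) d) = 0 := by
  induction d generalizing i with
  | zero => exact ⟨rfl, rfl, rfl, rfl⟩
  | succ d ih =>
    simpa [List.range'_succ, strandEnd, WordGraph.eraseStrand, strandBraids, strandComms,
      add_right_comm, add_assoc] using ih (i + 1)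

theorem strand_of_lt (hw : ∀ x ∈ w, x < i) :
    strandEnd i w = i ∧ WordGraph.eraseStrand i w = w ∧ strandBraids i w = 0 ∧
      strandComms i i w = 0 := by
  induction w with
  | nil => exact ⟨rfl, rfl, rfl, rfl⟩
  | cons x w ih =>
    rw [List.forall_mem_cons] at hw
    simpa [strandEnd, WordGraph.eraseStrand, strandBraids, strandComms, hw.1, hw.1.ne,
      show x ≠ i + 1 by omega] using ih hw.2

theorem strand_shift (k : ℕ) (hw : ∀ x ∈ w, 1 ≤ x) :
    strandEnd 0 (shift 1 w) = 0 ∧ WordGraph.eraseStrand 0 (shift 1 w) = w ∧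
      strandBraids 0 (shift 1 w) = w.length ∧
      strandComms k 0 (shift 1 w) = (k - 2) * w.length := by
  induction w with
  | nil => exact ⟨rfl, rfl, rfl, rfl⟩
  | cons x w ih =>
    rw [List.forall_mem_cons] at hw
    obtain ⟨h1, h2, h3, h4⟩ := ih hw.2
    simp [strandEnd, WordGraph.eraseStrand, strandBraids, strandComms, h1, h2, h3, h4,
      show x ≠ 0 by omega, mul_add, add_comm]

theorem strand_range'_append {n : ℕ} (hw : ∀ x ∈ w, x < n) :
    strandEnd 0 (List.range' 1 n ++ w) = n ∧
      WordGraph.eraseStrand 0 (List.range' 1 n ++ w) = w ∧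
      strandBraids 0 (List.range' 1 n ++ w) = 0 ∧
      strandComms n 0 (List.range' 1 n ++ w) = 0 := by
  have front := strand_range' n 0 n
  rw [zero_add, zero_add] at front
  obtain ⟨h1, h2, h3, h4⟩ := front
  simpa [strandEnd_append, eraseStrand_append, strandBraids_append, strandComms_append,
    h1, h2, h3, h4] using strand_of_lt hw

theorem strand_shift_append_range' (k : ℕ) (hw : ∀ x ∈ w, 1 ≤ x) :
    strandEnd 0 (shift 1 w ++ List.range' 1 k) = k ∧
      WordGraph.eraseStrand 0 (shift 1 w ++ List.range' 1 k) = w ∧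
      strandBraids 0 (shift 1 w ++ List.range' 1 k) = w.length ∧
      strandComms k 0 (shift 1 w ++ List.range' 1 k) = (k - 2) * w.length := by
  have back := strand_range' k 0 k
  rw [zero_add, zero_add] at back
  obtain ⟨h1, h2, h3, h4⟩ := strand_shift k hw
  simpa [strandEnd_append, eraseStrand_append, strandBraids_append, strandComms_append,
    h1, h2, h3, h4] using back

end StrandMoves

section InsertMin

variable {n : ℕ} {w v : List ℕ}

/-- The permutation of size `n + 1` that has its smallest value at position `k`, and the pattern
`α` on the other positions. -/
def insertMin (k : Fin (n + 1)) (α : Equiv.Perm (Fin n)) : Equiv.Perm (Fin (n + 1)) :=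
  Equiv.Perm.decomposeFin.symm (0, α) * k.cycleRange

@[simp] theorem insertMin_self (k : Fin (n + 1)) (α : Equiv.Perm (Fin n)) :
    insertMin k α k = 0 := by
  simp [insertMin]

@[simp] theorem insertMin_succAbove (k : Fin (n + 1)) (α : Equiv.Perm (Fin n)) (j : Fin n) :
    insertMin k α (k.succAbove j) = (α j).succ := by
  simp [insertMin]

theorem exists_eq_insertMin (π : Equiv.Perm (Fin (n + 1))) : ∃ α, π = insertMin (π.symm 0) α := by
  obtain ⟨⟨p, α⟩, h⟩ :=
    Equiv.Perm.decomposeFin.symm.surjective (π * (π.symm 0).cycleRange⁻¹)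
  have hp : p = 0 := by
    simpa [Equiv.Perm.inv_def] using congrArg (fun σ => σ 0) h
  subst hp
  exact ⟨α, by rw [insertMin, h, inv_mul_cancel_right]⟩

variable {k : Fin (n + 1)} {α : Equiv.Perm (Fin n)}

theorem val_succAbove (k : Fin (n + 1)) (j : Fin n) : (k.succAbove j : ℕ) = skip k j := by
  simp only [Fin.succAbove, skip, Fin.lt_def, Fin.val_castSucc]
  split_ifs <;> rfl

theorem isWord_insertMin_iff : IsWord (insertMin k α) w ↔
    (∀ x ∈ w, 1 ≤ x ∧ x < n + 1) ∧ strandEnd 0 w = k ∧ IsWord α (eraseStrand 0 w) := by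
  rw [isWord_iff, isWord_iff]
  refine and_congr_right fun hw => ?_
  have pos : ∀ x ∈ w, 1 ≤ x := fun x hx => (hw x hx).1
  have strand : natProd w k = 0 ↔ strandEnd 0 w = k :=
    ⟨fun h => (natProd w).injective ((natProd_strandEnd 0 pos).trans h.symm),
      fun h => h ▸ natProd_strandEnd 0 pos⟩
  rw [and_iff_right (eraseStrand_bounds (Nat.zero_le n) hw), Fin.forall_iff_succAbove k]
  simp only [insertMin_self, insertMin_succAbove, Fin.val_zero, Fin.val_succ, val_succAbove, strand]
  refine and_congr_right fun hk => forall_congr' fun j => ?_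
  rw [← hk, natProd_skip_strandEnd 0 pos]
  simp [skip]

theorem IsWord.shift_append_range' (hw : IsWord α w) :
    IsWord (insertMin k α) (shift 1 w ++ List.range' 1 k) := by
  obtain ⟨hend, herase, -⟩ := strand_shift_append_range' k hw.one_le
  refine isWord_insertMin_iff.2 ⟨fun x hx => ?_, hend, herase.symm ▸ hw⟩
  have := k.is_le
  rw [List.mem_append, mem_shift, List.mem_range'_1] at hx
  obtain ⟨y, hy, rfl⟩ | hx := hx
  · have := hw.lt y hy
    omega
  · omega

theorem exists_isWord (π : Equiv.Perm (Fin n)) : ∃ w, IsWord π w := by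
  induction n with
  | zero => exact ⟨[], by simp, Subsingleton.elim _ _⟩
  | succ n ih =>
    obtain ⟨α, h⟩ := exists_eq_insertMin π
    obtain ⟨w, hw⟩ := ih α
    exact ⟨_, h ▸ hw.shift_append_range'⟩

theorem nonempty_R (π : Equiv.Perm (Fin n)) : (R π).Nonempty :=
  let ⟨_, hw⟩ := exists_isWord π
  hw.exists_mem_R

theorem len_insertMin (k : Fin (n + 1)) (α : Equiv.Perm (Fin n)) :
    len (insertMin k α) = len α + k := by
  apply le_antisymm
  · obtain ⟨w, hw⟩ := nonempty_R α
    simpa [length_eq_len hw] using len_le_length (hw.1.shift_append_range' (k := k))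
  · obtain ⟨w, hw⟩ := nonempty_R (insertMin k α)
    obtain ⟨-, hk, hα⟩ := isWord_insertMin_iff.1 hw.1
    have := strandEnd_add_length_eraseStrand_le 0 w
    have := len_le_length hα
    have := length_eq_len hw
    omega

theorem mem_R_insertMin_iff : w ∈ R (insertMin k α) ↔
    (∀ x ∈ w, 1 ≤ x ∧ x < n + 1) ∧ Rises k 0 w ∧ eraseStrand 0 w ∈ R α := by
  rw [mem_R_iff, mem_R_iff, isWord_insertMin_iff, len_insertMin, rises_iff, and_assoc]
  refine and_congr_right fun _ => ?_
  rw [and_assoc, and_assoc]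
  refine and_congr_right fun hk => ?_
  have := strandEnd_add_length_eraseStrand_le 0 w
  constructor
  · rintro ⟨hα, hlen⟩
    have := len_le_length hα
    exact ⟨by omega, hα, by omega⟩
  · rintro ⟨hlen, hα, hle⟩
    exact ⟨hα, by omega⟩

theorem exists_movePath {π : Equiv.Perm (Fin n)} (hw : w ∈ R π) (hv : v ∈ R π) :
    ∃ t c, MovePath w v t c := by
  induction n generalizing w v with
  | zero =>
    obtain rfl := List.eq_nil_iff_forall_not_mem.2 fun x hx => absurd (hw.1.lt x hx) (by simp)
    obtain rfl := List.eq_nil_iff_forall_not_mem.2 fun x hx => absurd (hv.1.lt x hx) (by simp)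
    exact ⟨0, 0, .refl []⟩
  | succ n ih =>
    obtain ⟨α, h⟩ := exists_eq_insertMin π
    rw [h] at hw hv
    obtain ⟨hw, hwk, hwα⟩ := mem_R_insertMin_iff.1 hw
    obtain ⟨hv, hvk, hvα⟩ := mem_R_insertMin_iff.1 hv
    obtain ⟨t, c, p⟩ := ih hwα hvα
    obtain ⟨tw, cw, pw, -⟩ := hwk.exists_movePath_back fun x hx => (hw x hx).1
    obtain ⟨tv, cv, pv, -⟩ := hvk.exists_movePath_back fun x hx => (hv x hx).1
    exact ⟨_, _, (pw.trans ((p.shift 1).append_right _)).trans pv.symm⟩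

end InsertMin

section WordDiam

variable {n N N' θ κ t c : ℕ} {π : Equiv.Perm (Fin n)} {w v : List ℕ}

theorem MovePath.mem_R_iff (h : MovePath w v t c) : w ∈ R π ↔ v ∈ R π := by
  induction h with
  | refl => rfl
  | comm h _ ih => exact h.mem_R_iff.trans ih
  | braid h _ ih => exact (h.elim (·.mem_R_iff) (·.mem_R_iff.symm)).trans ih

/-- The reduced words of `π` have diameter `N` when a long braid move costs `θ` and a commutation
move costs `κ`. -/
structure IsWordDiam (θ κ : ℕ) (π : Equiv.Perm (Fin n)) (N : ℕ) : Prop where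
  within : ∀ w ∈ R π, ∀ v ∈ R π, Within θ κ N w v
  exists_far : ∃ w ∈ R π, ∃ v ∈ R π, ∀ t c, MovePath w v t c → N ≤ θ * t + κ * c

theorem IsWordDiam.unique (h : IsWordDiam θ κ π N) (h' : IsWordDiam θ κ π N') : N = N' := by
  obtain ⟨w, hw, v, hv, far⟩ := h.exists_far
  obtain ⟨w', hw', v', hv', far'⟩ := h'.exists_far
  obtain ⟨t, c, p, hN'⟩ := h'.within w hw v hv
  obtain ⟨t', c', p', hN⟩ := h.within w' hw' v' hv'
  exact le_antisymm ((far t c p).trans hN') ((far' t' c' p').trans hN)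

variable {α : Equiv.Perm (Fin n)}

theorem range'_append_mem_R (hw : w ∈ R α) :
    List.range' 1 n ++ w ∈ R (insertMin (Fin.last n) α) := by
  obtain ⟨hend, herase, -⟩ := strand_range'_append hw.1.lt
  refine mem_R_iff.2 ⟨isWord_insertMin_iff.2 ⟨fun x hx => ?_, hend, herase.symm ▸ hw.1⟩, ?_⟩
  · rw [List.mem_append, List.mem_range'_1] at hx
    obtain hx | hx := hx
    · omega
    · have := hw.1.1 x hx
      omega
  · simp [len_insertMin, length_eq_len hw, add_comm]

theorem shift_append_range'_mem_R {k : Fin (n + 1)} (hw : w ∈ R α) :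
    shift 1 w ++ List.range' 1 k ∈ R (insertMin k α) :=
  mem_R_iff.2 ⟨hw.1.shift_append_range', by simp [len_insertMin, length_eq_len hw]⟩

theorem within_insertMin_last (h : ∀ w ∈ R α, ∀ v ∈ R α, Within θ κ N w v)
    (hw : w ∈ R (insertMin (Fin.last n) α)) (hv : v ∈ R (insertMin (Fin.last n) α)) :
    Within θ κ (N + (θ + κ * (n - 2)) * len α) w v := by
  obtain ⟨hw, rw, ew⟩ := mem_R_insertMin_iff.1 hw
  obtain ⟨hv, rv, ev⟩ := mem_R_insertMin_iff.1 hv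
  rw [Fin.val_last] at rw rv
  have hw' : ∀ x ∈ w, x ≤ n := fun x hx => Nat.le_of_lt_succ (hw x hx).2
  have hv' : ∀ x ∈ v, x ≤ n := fun x hx => Nat.le_of_lt_succ (hv x hx).2
  obtain ⟨t, c, p, hN⟩ := h _ ew _ ev
  obtain ⟨tw, cw, pw, htw, hcw⟩ := rw.exists_movePath_back fun x hx => (hw x hx).1
  obtain ⟨tv, cv, pv, htv, hcv⟩ := rv.exists_movePath_back fun x hx => (hv x hx).1
  replace hcw := hcw hw'
  replace hcv := hcv hv'
  rw [length_eq_len ew] at htw hcw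
  rw [length_eq_len ev] at htv hcv
  have front := ((rw.movePath_front hw').trans (p.append_left _)).trans (rv.movePath_front hv').symm
  have back := (pw.trans ((p.shift 1).append_right _)).trans pv.symm
  refine (Within.of_add_eq_two_mul (T := t + len α) (D := c + (n - 2) * len α) front back
    (by omega) (by omega)).mono ?_
  linarith

theorem IsWordDiam.insertMin_last (h : IsWordDiam θ κ α N) :
    IsWordDiam θ κ (insertMin (Fin.last n) α) (N + (θ + κ * (n - 2)) * len α) where
  within _ hw _ hv := within_insertMin_last h.within hw hv
  exists_far := by
    obtain ⟨w, hw, v, hv, far⟩ := h.exists_far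
    have hw₀ := range'_append_mem_R hw
    refine ⟨_, hw₀, _, shift_append_range'_mem_R hv, fun t c p => ?_⟩
    obtain ⟨-, hew, hbw, hcw⟩ := strand_range'_append hw.1.lt
    obtain ⟨-, hev, hbv, hcv⟩ := strand_shift_append_range' n hv.1.one_le
    obtain ⟨t', c', p', ht, hc⟩ :=
      p.eraseStrand fun _ _ _ q => (mem_R_insertMin_iff.1 (q.mem_R_iff.1 hw₀)).2.1
    rw [Fin.val_last] at p' ht hc
    rw [hew, hev] at p'
    rw [hbw, hbv, length_eq_len hv, zero_add] at ht
    rw [hcw, hcv, length_eq_len hv, zero_add] at hc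
    have hN := far t' c' p'
    calc N + (θ + κ * (n - 2)) * len α
        ≤ θ * (len α + t') + κ * ((n - 2) * len α + c') := by linarith
      _ ≤ θ * t + κ * c := by gcongr

end WordDiam

section LowHigh

variable {m t c : ℕ} {w v : List ℕ}

/-- The letters of `w` below `m`. -/
def lo (m : ℕ) (w : List ℕ) : List ℕ := w.filter (· < m)

/-- The letters of `w` above `m`, lowered by `m`. -/
def hi (m : ℕ) (w : List ℕ) : List ℕ := (w.filter (m < ·)).map (· - m)

/-- The number of pairs of a letter above `m` and a later letter below `m`. -/
def cross (m : ℕ) : List ℕ → ℕ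
  | [] => 0
  | x :: w => (if m < x then (lo m w).length else 0) + cross m w

@[simp] theorem lo_append (m : ℕ) (w v : List ℕ) : lo m (w ++ v) = lo m w ++ lo m v := by
  simp [lo]

@[simp] theorem hi_append (m : ℕ) (w v : List ℕ) : hi m (w ++ v) = hi m w ++ hi m v := by
  simp [hi]

theorem lo_lt : ∀ x ∈ lo m w, x < m := by
  simp [lo]

theorem one_le_hi : ∀ x ∈ hi m w, 1 ≤ x := by
  simp only [hi, List.mem_map, List.mem_filter, decide_eq_true_eq]
  omega

@[simp] theorem lo_shift (m : ℕ) (w : List ℕ) : lo m (shift m w) = [] := by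
  simp [lo, shift]

theorem hi_shift (hw : ∀ x ∈ w, 1 ≤ x) : hi m (shift m w) = w := by
  have : w.filter (0 < ·) = w := by simpa [Nat.succ_le_iff] using hw
  simp [hi, shift, List.filter_map, Function.comp_def, this]

theorem lo_of_lt (hw : ∀ x ∈ w, x < m) : lo m w = w := by
  simpa [lo] using hw

theorem hi_of_lt (hw : ∀ x ∈ w, x < m) : hi m w = [] := by
  simpa [hi] using fun x hx => (hw x hx).le

theorem cross_of_lt (hw : ∀ x ∈ w, x < m) : cross m w = 0 := by
  induction w with
  | nil => rfl
  | cons x w ih =>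
    rw [List.forall_mem_cons] at hw
    simp [cross, hw.1.le, ih hw.2]

theorem cross_shift (m : ℕ) (w : List ℕ) : cross m (shift m w) = 0 := by
  induction w with
  | nil => rfl
  | cons x w ih => simp [cross, ih]

theorem lo_cons_of_lt {x : ℕ} (w : List ℕ) (h : x < m) : lo m (x :: w) = x :: lo m w := by
  simp [lo, h]

theorem lo_cons_of_gt {x : ℕ} (w : List ℕ) (h : m < x) : lo m (x :: w) = lo m w := by
  simp [lo, h.le]

theorem hi_cons_of_lt {x : ℕ} (w : List ℕ) (h : x < m) : hi m (x :: w) = hi m w := by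
  simp [hi, h.le]

theorem hi_cons_of_gt {x : ℕ} (w : List ℕ) (h : m < x) :
    hi m (x :: w) = (x - m) :: hi m w := by
  simp [hi, h]

theorem cross_append (m : ℕ) (w v : List ℕ) :
    cross m (w ++ v) = cross m w + cross m v + (hi m w).length * (lo m v).length := by
  induction w with
  | nil => simp [cross, hi]
  | cons x w ih =>
    rw [List.cons_append, cross, cross, ih, lo_append, List.length_append]
    by_cases hx : m < x
    · rw [hi_cons_of_gt _ hx, if_pos hx, if_pos hx, List.length_cons]
      ring
    · rw [if_neg hx, if_neg hx]
      simp [hi, hx]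

theorem length_lo_add_length_hi (hw : m ∉ w) :
    (lo m w).length + (hi m w).length = w.length := by
  induction w with
  | nil => rfl
  | cons x w ih =>
    rw [List.mem_cons, not_or] at hw
    have := ih hw.2
    rcases lt_or_gt_of_ne hw.1 with h | h
    · rw [lo_cons_of_gt _ h, hi_cons_of_gt _ h, List.length_cons, List.length_cons]
      omega
    · rw [lo_cons_of_lt _ h, hi_cons_of_lt _ h, List.length_cons, List.length_cons]
      omega

theorem movePath_lo_append_hi (hw : m ∉ w) :
    MovePath w (lo m w ++ shift m (hi m w)) 0 (cross m w) := by
  induction w with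
  | nil => exact .refl _
  | cons x w ih =>
    rw [List.mem_cons, not_or] at hw
    rcases lt_or_gt_of_ne hw.1 with h | h
    · rw [lo_cons_of_gt _ h, hi_cons_of_gt _ h]
      have past := MovePath.cons_concat (x := x) (l := lo m w) fun y hy => by
        have := lo_lt y hy
        omega
      simpa [cross, h, h.le] using (((ih hw.2).cons x).trans
        (past.append_right (shift m (hi m w)))).cast rfl (add_comm _ _)
    · rw [lo_cons_of_lt _ h, hi_cons_of_lt _ h]
      simpa [cross, h.not_gt] using (ih hw.2).cons x

theorem exists_movePath_hi_append_lo (hw : m ∉ w) :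
    ∃ c, MovePath w (shift m (hi m w) ++ lo m w) 0 c ∧
      cross m w + c = (lo m w).length * (hi m w).length := by
  induction w with
  | nil => exact ⟨0, .refl _, rfl⟩
  | cons x w ih =>
    rw [List.mem_cons, not_or] at hw
    obtain ⟨c, p, hc⟩ := ih hw.2
    rcases lt_or_gt_of_ne hw.1 with h | h
    · rw [lo_cons_of_gt _ h, hi_cons_of_gt _ h]
      refine ⟨c, by simpa [h.le] using p.cons x, ?_⟩
      simp only [cross, h, if_true, List.length_cons, Nat.mul_succ]
      omega
    · rw [lo_cons_of_lt _ h, hi_cons_of_lt _ h]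
      have past := MovePath.cons_concat (x := x) (l := shift m (hi m w)) fun y hy => by
        obtain ⟨z, hz, rfl⟩ := mem_shift.1 hy
        have := one_le_hi z hz
        omega
      refine ⟨c + (hi m w).length, by simpa using (p.cons x).trans (past.append_right (lo m w)), ?_⟩
      simp only [cross, h.not_gt, if_false, List.length_cons, Nat.succ_mul]
      omega

theorem CommMove.lo_hi (h : CommMove w v) (hw : m ∉ w) :
    ∃ c₁ c₂, MovePath (lo m w) (lo m v) 0 c₁ ∧ MovePath (hi m w) (hi m v) 0 c₂ ∧
      cross m v + (c₁ + c₂) ≤ cross m w + 1 := by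
  obtain ⟨p, q, j, k, hjk, rfl, rfl⟩ := h
  simp only [List.mem_append, List.mem_cons, not_or] at hw
  obtain ⟨⟨-, hj, hk, -⟩, -⟩ := hw
  simp only [List.append_assoc, List.cons_append, List.nil_append, cross_append,
    lo_append, hi_append]
  rcases lt_or_gt_of_ne hj with hj | hj <;> rcases lt_or_gt_of_ne hk with hk | hk
  · simp only [lo_cons_of_gt _ hj, lo_cons_of_gt _ hk, hi_cons_of_gt _ hj, hi_cons_of_gt _ hk,
      cross, hj, hk, if_true]
    exact ⟨0, 1, .refl _, .of_comm ⟨hi m p, hi m q, j - m, k - m, by omega, by simp, by simp⟩,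
      by omega⟩
  · simp only [lo_cons_of_gt _ hj, lo_cons_of_lt _ hk, hi_cons_of_gt _ hj, hi_cons_of_lt _ hk,
      cross, hj, hk.not_gt, if_true, if_false, List.length_cons]
    exact ⟨0, 0, .refl _, .refl _, by omega⟩
  · simp only [lo_cons_of_lt _ hj, lo_cons_of_gt _ hk, hi_cons_of_lt _ hj, hi_cons_of_gt _ hk,
      cross, hj.not_gt, hk, if_true, if_false, List.length_cons]
    exact ⟨0, 0, .refl _, .refl _, by omega⟩
  · simp only [lo_cons_of_lt _ hj, lo_cons_of_lt _ hk, hi_cons_of_lt _ hj, hi_cons_of_lt _ hk,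
      cross, hj.not_gt, hk.not_gt, if_false, List.length_cons]
    exact ⟨1, 0, .of_comm ⟨lo m p, lo m q, j, k, hjk, by simp, by simp⟩, .refl _, by omega⟩

theorem BraidMove.lo_hi (h : BraidMove w v) (hw : m ∉ w) :
    ∃ t₁ t₂, MovePath (lo m w) (lo m v) t₁ 0 ∧ MovePath (hi m w) (hi m v) t₂ 0 ∧
      t₁ + t₂ = 1 ∧ cross m v = cross m w := by
  obtain ⟨p, q, j, rfl, rfl⟩ := h
  simp only [List.mem_append, List.mem_cons, not_or] at hw
  obtain ⟨⟨-, hj, hk, -⟩, -⟩ := hw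
  simp only [List.append_assoc, List.cons_append, List.nil_append, cross_append,
    lo_append, hi_append]
  rcases lt_or_gt_of_ne hj with hj | hj
  · have hk : m < j + 1 := by omega
    simp only [lo_cons_of_gt _ hj, lo_cons_of_gt _ hk, hi_cons_of_gt _ hj, hi_cons_of_gt _ hk,
      cross, hj, hk, if_true, show j + 1 - m = j - m + 1 by omega]
    exact ⟨0, 1, .refl _, .of_braid (.inl ⟨hi m p, hi m q, j - m, by simp, by simp⟩), rfl, trivial⟩
  · have hk : j + 1 < m := by omega
    simp only [lo_cons_of_lt _ hj, lo_cons_of_lt _ hk, hi_cons_of_lt _ hj, hi_cons_of_lt _ hk,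
      cross, hj.not_gt, hk.not_gt, if_false, List.length_cons]
    exact ⟨1, 0, .of_braid (.inl ⟨lo m p, lo m q, j, by simp, by simp⟩), .refl _, rfl, trivial⟩

theorem MovePath.lo_hi (h : MovePath w v t c) (hw : m ∉ w) :
    ∃ t₁ c₁ t₂ c₂, MovePath (lo m w) (lo m v) t₁ c₁ ∧ MovePath (hi m w) (hi m v) t₂ c₂ ∧
      t₁ + t₂ = t ∧ cross m v + (c₁ + c₂) ≤ cross m w + c := by
  induction h with
  | refl => exact ⟨0, 0, 0, 0, .refl _, .refl _, rfl, le_rfl⟩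
  | comm h _ ih =>
    obtain ⟨t₁, c₁, t₂, c₂, p₁, p₂, ht, hc⟩ := ih fun hm => hw ((h.mem_iff m).2 hm)
    obtain ⟨d₁, d₂, q₁, q₂, hd⟩ := h.lo_hi hw
    exact ⟨_, _, _, _, q₁.trans p₁, q₂.trans p₂, by omega, by omega⟩
  | braid h _ ih =>
    rcases h with h | h
    · obtain ⟨t₁, c₁, t₂, c₂, p₁, p₂, ht, hc⟩ := ih fun hm => hw ((h.mem_iff m).2 hm)
      obtain ⟨s₁, s₂, q₁, q₂, hs, hd⟩ := h.lo_hi hw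
      exact ⟨_, _, _, _, q₁.trans p₁, q₂.trans p₂, by omega, by omega⟩
    · have hu := fun hm => hw ((h.mem_iff m).1 hm)
      obtain ⟨t₁, c₁, t₂, c₂, p₁, p₂, ht, hc⟩ := ih hu
      obtain ⟨s₁, s₂, q₁, q₂, hs, hd⟩ := h.lo_hi hu
      exact ⟨_, _, _, _, q₁.symm.trans p₁, q₂.symm.trans p₂, by omega, by omega⟩

end LowHigh

section InflateTwelve

theorem Rises.sub_one_mem_eraseStrand {k i x : ℕ} {w : List ℕ} (h : Rises k i w) (hk : k < x)
    (hx : x ∈ w) : x - 1 ∈ eraseStrand i w := by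
  induction w generalizing i with
  | nil => simp at hx
  | cons y w ih =>
    simp only [Rises] at h
    simp only [eraseStrand]
    split_ifs at h ⊢ with h1 h2 h3
    · have := h.le
      exact ih h (List.mem_of_ne_of_mem (by omega) hx)
    · exact absurd h2 h.1
    all_goals
      have := h.2.le
      obtain rfl | hx := List.mem_cons.1 hx
      · first | omega | exact List.mem_cons_self
      · exact List.mem_cons_of_mem _ (ih h.2 hx)

theorem notMem_of_forall_lt_iff {n a : ℕ} {π : Equiv.Perm (Fin n)} {w : List ℕ}
    (hπ : ∀ i : Fin n, (π i : ℕ) < a ↔ (i : ℕ) < a) (hw : w ∈ R π) : a ∉ w := by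
  induction n generalizing a w with
  | zero => exact fun ha => absurd (hw.1.lt a ha) (by simp)
  | succ n ih =>
    intro ha
    obtain ⟨α, h⟩ := exists_eq_insertMin π
    generalize π.symm 0 = k at h
    subst h
    obtain ⟨hw, hk, hα⟩ := mem_R_insertMin_iff.1 hw
    have hka : (k : ℕ) < a := (hπ k).1 (by simpa [Nat.succ_le_iff] using (hw a ha).1)
    refine ih (a := a - 1) (fun j => ?_) hα (hk.sub_one_mem_eraseStrand hka ha)
    have := hπ (k.succAbove j)
    rw [insertMin_succAbove, Fin.val_succ, val_succAbove, skip] at this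
    split_ifs at this <;> omega

variable {a b : ℕ} {α : Equiv.Perm (Fin a)} {β : Equiv.Perm (Fin b)} {u v w : List ℕ}

@[simp] theorem inflate12_castAdd (i : Fin a) :
    inflate12 α β (Fin.castAdd b i) = Fin.castAdd b (α i) := by
  simp [inflate12]

@[simp] theorem inflate12_natAdd (j : Fin b) :
    inflate12 α β (Fin.natAdd a j) = Fin.natAdd a (β j) := by
  simp [inflate12]

theorem natProd_of_forall_lt (hu : ∀ x ∈ u, x < a) {y : ℕ} (hy : a ≤ y) : natProd u y = y := by
  induction u with
  | nil => rfl
  | cons x u ih =>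
    rw [List.forall_mem_cons] at hu
    rw [natProd_cons, Equiv.Perm.mul_apply, ih hu.2, natSimple_apply, if_neg (by omega),
      if_neg (by omega)]

theorem natProd_shift_of_lt (hv : ∀ x ∈ v, 1 ≤ x) {y : ℕ} (hy : y < a) :
    natProd (shift a v) y = y := by
  induction v with
  | nil => rfl
  | cons x v ih =>
    rw [List.forall_mem_cons] at hv
    rw [shift_cons, natProd_cons, Equiv.Perm.mul_apply, ih hv.2, natSimple_apply,
      if_neg (by omega), if_neg (by omega)]

theorem natProd_shift_add (hv : ∀ x ∈ v, 1 ≤ x) (y : ℕ) :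
    natProd (shift a v) (a + y) = a + natProd v y := by
  induction v with
  | nil => rfl
  | cons x v ih =>
    rw [List.forall_mem_cons] at hv
    rw [shift_cons, natProd_cons, Equiv.Perm.mul_apply, ih hv.2, natProd_cons,
      Equiv.Perm.mul_apply, natSimple_apply, natSimple_apply]
    split_ifs <;> omega

theorem isWord_inflate12_iff (hu : ∀ x ∈ u, x < a) (hv : ∀ x ∈ v, 1 ≤ x) :
    IsWord (inflate12 α β) (u ++ shift a v) ↔ IsWord α u ∧ IsWord β v := by
  have letters : (∀ x ∈ u ++ shift a v, 1 ≤ x ∧ x < a + b) ↔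
      (∀ x ∈ u, 1 ≤ x ∧ x < a) ∧ ∀ x ∈ v, 1 ≤ x ∧ x < b := by
    simp only [List.forall_mem_append, shift, List.forall_mem_map]
    grind
  simp only [isWord_iff, letters, Fin.forall_fin_add, inflate12_castAdd, inflate12_natAdd,
    Fin.val_castAdd, Fin.val_natAdd, natProd_append, Equiv.Perm.mul_apply, natProd_shift_add hv,
    natProd_shift_of_lt hv (Fin.is_lt _), natProd_of_forall_lt hu (Nat.le_add_right _ _),
    Nat.add_left_cancel_iff]
  exact and_and_and_comm

theorem notMem_of_mem_R_inflate12 (hw : w ∈ R (inflate12 α β)) : a ∉ w := by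
  refine notMem_of_forall_lt_iff ?_ hw
  rw [Fin.forall_fin_add]
  simp

theorem isWord_lo_hi (hw : w ∈ R (inflate12 α β)) : IsWord α (lo a w) ∧ IsWord β (hi a w) :=
  (isWord_inflate12_iff lo_lt one_le_hi).1
    ((movePath_lo_append_hi (notMem_of_mem_R_inflate12 hw)).mem_R_iff.1 hw).1

theorem len_inflate12 (α : Equiv.Perm (Fin a)) (β : Equiv.Perm (Fin b)) :
    len (inflate12 α β) = len α + len β := by
  apply le_antisymm
  · obtain ⟨u, hu⟩ := nonempty_R α
    obtain ⟨v, hv⟩ := nonempty_R β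
    simpa [length_eq_len hu, length_eq_len hv] using
      len_le_length ((isWord_inflate12_iff hu.1.lt hv.1.one_le).2 ⟨hu.1, hv.1⟩)
  · obtain ⟨w, hw⟩ := nonempty_R (inflate12 α β)
    obtain ⟨hα, hβ⟩ := isWord_lo_hi hw
    rw [← length_eq_len hw, ← length_lo_add_length_hi (notMem_of_mem_R_inflate12 hw)]
    exact add_le_add (len_le_length hα) (len_le_length hβ)

theorem mem_R_inflate12_iff :
    w ∈ R (inflate12 α β) ↔ a ∉ w ∧ lo a w ∈ R α ∧ hi a w ∈ R β := by
  constructor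
  · intro hw
    have ha := notMem_of_mem_R_inflate12 hw
    obtain ⟨hα, hβ⟩ := isWord_lo_hi hw
    have := len_le_length hα
    have := len_le_length hβ
    have := length_lo_add_length_hi ha
    have := length_eq_len hw
    rw [len_inflate12] at this
    exact ⟨ha, mem_R_iff.2 ⟨hα, by omega⟩, mem_R_iff.2 ⟨hβ, by omega⟩⟩
  · rintro ⟨ha, hα, hβ⟩
    refine (movePath_lo_append_hi ha).mem_R_iff.2 (mem_R_iff.2
      ⟨(isWord_inflate12_iff lo_lt one_le_hi).2 ⟨hα.1, hβ.1⟩, ?_⟩)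
    simp [len_inflate12, length_eq_len hα, length_eq_len hβ]

theorem append_shift_mem_R (hu : u ∈ R α) (hv : v ∈ R β) :
    u ++ shift a v ∈ R (inflate12 α β) :=
  mem_R_iff.2 ⟨(isWord_inflate12_iff hu.1.lt hv.1.one_le).2 ⟨hu.1, hv.1⟩,
    by simp [len_inflate12, length_eq_len hu, length_eq_len hv]⟩

variable {θ κ N M : ℕ}

theorem within_inflate12 (hα : ∀ w ∈ R α, ∀ v ∈ R α, Within θ κ N w v)
    (hβ : ∀ w ∈ R β, ∀ v ∈ R β, Within θ κ M w v)
    (hw : w ∈ R (inflate12 α β)) (hv : v ∈ R (inflate12 α β)) :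
    Within θ κ (N + M + κ * (len α * len β)) w v := by
  obtain ⟨haw, hαw, hβw⟩ := mem_R_inflate12_iff.1 hw
  obtain ⟨hav, hαv, hβv⟩ := mem_R_inflate12_iff.1 hv
  obtain ⟨t₁, c₁, p₁, hN⟩ := hα _ hαw _ hαv
  obtain ⟨t₂, c₂, p₂, hM⟩ := hβ _ hβw _ hβv
  obtain ⟨cw, pw, hcw⟩ := exists_movePath_hi_append_lo haw
  obtain ⟨cv, pv, hcv⟩ := exists_movePath_hi_append_lo hav
  rw [length_eq_len hαw, length_eq_len hβw] at hcw
  rw [length_eq_len hαv, length_eq_len hβv] at hcv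
  have lo_first := ((movePath_lo_append_hi haw).trans
    ((p₁.append_right _).trans ((p₂.shift a).append_left _))).trans (movePath_lo_append_hi hav).symm
  have hi_first := (pw.trans
    (((p₂.shift a).append_right _).trans (p₁.append_left _))).trans pv.symm
  refine (Within.of_add_eq_two_mul (T := t₁ + t₂) (D := c₁ + c₂ + len α * len β)
    lo_first hi_first (by omega) (by omega)).mono ?_
  linarith

theorem IsWordDiam.inflate12 (hα : IsWordDiam θ κ α N) (hβ : IsWordDiam θ κ β M) :
    IsWordDiam θ κ (inflate12 α β) (N + M + κ * (len α * len β)) where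
  within _ hw _ hv := within_inflate12 hα.within hβ.within hw hv
  exists_far := by
    obtain ⟨u, hu, u', hu', farα⟩ := hα.exists_far
    obtain ⟨v, hv, v', hv', farβ⟩ := hβ.exists_far
    have hw := append_shift_mem_R hu hv
    have ha : a ∉ shift a v' ++ u' := fun h => by
      obtain h | h := List.mem_append.1 h
      · obtain ⟨y, hy, hya⟩ := mem_shift.1 h
        have := hv'.1.one_le y hy
        omega
      · exact lt_irrefl a (hu'.1.lt a h)
    refine ⟨_, hw, shift a v' ++ u', mem_R_inflate12_iff.2 ⟨ha, ?_, ?_⟩, fun t c p => ?_⟩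
    · simpa [lo_of_lt hu'.1.lt] using hu'
    · simpa [hi_of_lt hu'.1.lt, hi_shift hv'.1.one_le] using hv'
    obtain ⟨t₁, c₁, t₂, c₂, p₁, p₂, rfl, hc⟩ := p.lo_hi (notMem_of_mem_R_inflate12 hw)
    simp only [lo_append, hi_append, lo_shift, hi_shift hv.1.one_le, hi_shift hv'.1.one_le,
      lo_of_lt hu.1.lt, lo_of_lt hu'.1.lt, hi_of_lt hu.1.lt, hi_of_lt hu'.1.lt, List.nil_append,
      List.append_nil, cross_append, cross_of_lt hu.1.lt, cross_of_lt hu'.1.lt, cross_shift,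
      List.length_nil, length_eq_len hu', length_eq_len hv', zero_mul, zero_add] at p₁ p₂ hc
    have hN := farα t₁ c₁ p₁
    have hM := farβ t₂ c₂ p₂
    calc N + M + κ * (len α * len β)
        ≤ θ * (t₁ + t₂) + κ * (len β * len α + (c₁ + c₂)) := by linarith
      _ ≤ θ * (t₁ + t₂) + κ * c := by gcongr

end InflateTwelve

section Graphs

variable {V : Type*} {Γ H : SimpleGraph V} {a b : V}

theorem edist_contract_le_one (h : Γ.Adj a b) :
    (contract Γ H).edist (H.connectedComponentMk a) (H.connectedComponentMk b) ≤ 1 := by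
  rw [SimpleGraph.edist_le_one_iff_adj_or_eq, or_iff_not_imp_right]
  exact fun hne => ⟨hne, a, b, rfl, rfl, h⟩

theorem edist_contract_eq_zero (h : H.Adj a b) :
    (contract Γ H).edist (H.connectedComponentMk a) (H.connectedComponentMk b) = 0 :=
  SimpleGraph.edist_eq_zero_iff.2 (SimpleGraph.ConnectedComponent.sound h.reachable)

variable {n θ κ : ℕ} {π : Equiv.Perm (Fin n)} {q : R π → V}

/-- The graph `Γ` measures costs of moves: its vertices are labelled by reduced words of `π`
through `q`, and its distances are the least costs of paths of moves when a long braid move costs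
`θ` and a commutation move costs `κ`. -/
structure MeasuresCost (θ κ : ℕ) (Γ : SimpleGraph V) (q : R π → V) : Prop where
  surjective : Function.Surjective q
  edist_comm_le : ∀ {w v : R π}, CommMove w v → Γ.edist (q w) (q v) ≤ κ
  edist_braid_le : ∀ {w v : R π}, BraidMove w v → Γ.edist (q w) (q v) ≤ θ
  within_of_eq : ∀ {w v : R π}, q w = q v → Within θ κ 0 w v
  within_of_adj : ∀ {w v : R π}, Γ.Adj (q w) (q v) → Within θ κ 1 w v

namespace MeasuresCost

theorem edist_le (h : MeasuresCost θ κ Γ q) {w v : List ℕ} (p : MovePath w v t c) (hw : w ∈ R π)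
    (hv : v ∈ R π) : Γ.edist (q ⟨w, hw⟩) (q ⟨v, hv⟩) ≤ (θ * t + κ * c : ℕ) := by
  induction p with
  | refl => simp
  | @comm w v u t c m _ ih =>
    have hv' := m.mem_R_iff.1 hw
    calc Γ.edist (q ⟨w, hw⟩) (q ⟨u, hv⟩)
        ≤ Γ.edist (q ⟨w, hw⟩) (q ⟨v, hv'⟩) + Γ.edist (q ⟨v, hv'⟩) (q ⟨u, hv⟩) :=
          SimpleGraph.edist_triangle
      _ ≤ κ + (θ * t + κ * c : ℕ) := add_le_add (h.edist_comm_le m) (ih hv' hv)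
      _ = (θ * t + κ * (c + 1) : ℕ) := by push_cast; ring
  | @braid w v u t c m _ ih =>
    have hv' := (MovePath.of_braid m).mem_R_iff.1 hw
    have hm : Γ.edist (q ⟨w, hw⟩) (q ⟨v, hv'⟩) ≤ θ :=
      m.elim (fun m => h.edist_braid_le m) fun m =>
        SimpleGraph.edist_comm.trans_le (h.edist_braid_le m)
    calc Γ.edist (q ⟨w, hw⟩) (q ⟨u, hv⟩)
        ≤ Γ.edist (q ⟨w, hw⟩) (q ⟨v, hv'⟩) + Γ.edist (q ⟨v, hv'⟩) (q ⟨u, hv⟩) :=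
          SimpleGraph.edist_triangle
      _ ≤ θ + (θ * t + κ * c : ℕ) := add_le_add hm (ih hv' hv)
      _ = (θ * (t + 1) + κ * c : ℕ) := by push_cast; ring

theorem within_length (h : MeasuresCost θ κ Γ q) (p : Γ.Walk a b) {w v : R π} (hw : q w = a)
    (hv : q v = b) : Within θ κ p.length w v := by
  induction p generalizing w with
  | nil => exact h.within_of_eq (hw.trans hv.symm)
  | @cons _ x _ hadj p ih =>
    obtain ⟨u, rfl⟩ := h.surjective x
    rw [SimpleGraph.Walk.length_cons, add_comm]
    exact (h.within_of_adj (hw ▸ hadj)).trans (ih rfl hv)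

theorem connected (h : MeasuresCost θ κ Γ q) : Γ.Connected where
  preconnected x y := by
    obtain ⟨w, rfl⟩ := h.surjective x
    obtain ⟨v, rfl⟩ := h.surjective y
    obtain ⟨t, c, p⟩ := exists_movePath w.2 v.2
    exact SimpleGraph.reachable_of_edist_ne_top
      ((h.edist_le p w.2 v.2).trans_lt (ENat.natCast_lt_top _)).ne
  nonempty := (nonempty_R π).to_subtype.map q

theorem isWordDiam (h : MeasuresCost θ κ Γ q) : IsWordDiam θ κ π Γ.diam := by
  have hconn := h.connected
  have := hconn.nonempty
  have := (finite_R π).to_subtype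
  have := Finite.of_surjective q h.surjective
  constructor
  · intro w hw v hv
    obtain ⟨p, hp⟩ := hconn.exists_walk_length_eq_dist (q ⟨w, hw⟩) (q ⟨v, hv⟩)
    refine (h.within_length p (w := ⟨w, hw⟩) (v := ⟨v, hv⟩) rfl rfl).mono (hp.trans_le ?_)
    exact SimpleGraph.dist_le_diam (SimpleGraph.connected_iff_ediam_ne_top.1 hconn)
  · obtain ⟨x, y, hxy⟩ := Γ.exists_dist_eq_diam
    obtain ⟨w, rfl⟩ := h.surjective x
    obtain ⟨v, rfl⟩ := h.surjective y
    refine ⟨w, w.2, v, v.2, fun t c p => hxy ▸ ?_⟩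
    have := h.edist_le p w.2 v.2
    rwa [← (hconn (q w) (q v)).coe_dist_eq_edist, Nat.cast_le] at this

end MeasuresCost

theorem CommMove.adj {w v : R π} (h : CommMove w v) : (commGraph π).Adj w v :=
  (SimpleGraph.fromRel_adj _ _ _).2 ⟨fun hwv => h.ne (congrArg Subtype.val hwv), .inl h⟩

theorem BraidMove.adj {w v : R π} (h : BraidMove w v) : (braidGraph π).Adj w v :=
  (SimpleGraph.fromRel_adj _ _ _).2 ⟨fun hwv => h.ne (congrArg Subtype.val hwv), .inl h⟩

theorem within_of_commGraph_adj {w v : R π} (h : (commGraph π).Adj w v) : Within θ κ κ w v :=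
  ⟨0, 1, .of_comm (((SimpleGraph.fromRel_adj _ _ _).1 h).2.elim id (·.symm)), by simp⟩

theorem within_of_braidGraph_adj {w v : R π} (h : (braidGraph π).Adj w v) : Within θ κ θ w v :=
  ⟨1, 0, .of_braid ((SimpleGraph.fromRel_adj _ _ _).1 h).2, by simp⟩

theorem within_of_G_adj {w v : R π} (h : (G π).Adj w v) : Within θ κ (max θ κ) w v :=
  h.elim (within_of_commGraph_adj · |>.mono (le_max_right θ κ))
    (within_of_braidGraph_adj · |>.mono (le_max_left θ κ))

theorem within_zero_of_reachable {H : SimpleGraph (R π)}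
    (hH : ∀ {w v : R π}, H.Adj w v → Within θ κ 0 w v) {w v : R π} (h : H.Reachable w v) :
    Within θ κ 0 w v := by
  obtain ⟨p⟩ := h
  induction p with
  | nil => exact ⟨0, 0, .refl _, by simp⟩
  | cons h _ ih => exact (hH h).trans ih

theorem within_one_of_contract_adj {H : SimpleGraph (R π)} (hmax : max θ κ ≤ 1)
    (hH : ∀ {w v : R π}, H.Adj w v → Within θ κ 0 w v) {w v : R π}
    (h : (contract (G π) H).Adj (H.connectedComponentMk w) (H.connectedComponentMk v)) :
    Within θ κ 1 w v := by
  obtain ⟨-, w', v', hw, hv, hadj⟩ := h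
  have hw := within_zero_of_reachable hH (SimpleGraph.ConnectedComponent.exact hw)
  have hv := within_zero_of_reachable hH (SimpleGraph.ConnectedComponent.exact hv)
  exact ((hw.symm.trans ((within_of_G_adj hadj).mono hmax)).trans hv).mono (by simp)

theorem measuresCost_G (π : Equiv.Perm (Fin n)) : MeasuresCost 1 1 (G π) id where
  surjective := Function.surjective_id
  edist_comm_le h := SimpleGraph.edist_le_one_iff_adj_or_eq.2 (.inl (.inl h.adj))
  edist_braid_le h := SimpleGraph.edist_le_one_iff_adj_or_eq.2 (.inl (.inr h.adj))
  within_of_eq h := by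
    rw [id, id] at h
    exact ⟨0, 0, h ▸ .refl _, by simp⟩
  within_of_adj := within_of_G_adj

theorem measuresCost_C (π : Equiv.Perm (Fin n)) :
    MeasuresCost 1 0 (C π) (commGraph π).connectedComponentMk where
  surjective := Quot.mk_surjective
  edist_comm_le h := (edist_contract_eq_zero h.adj).le
  edist_braid_le h := edist_contract_le_one (.inr h.adj)
  within_of_eq h :=
    within_zero_of_reachable within_of_commGraph_adj (SimpleGraph.ConnectedComponent.exact h)
  within_of_adj := within_one_of_contract_adj le_rfl within_of_commGraph_adj

theorem measuresCost_B (π : Equiv.Perm (Fin n)) :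
    MeasuresCost 0 1 (B π) (braidGraph π).connectedComponentMk where
  surjective := Quot.mk_surjective
  edist_comm_le h := edist_contract_le_one (.inl h.adj)
  edist_braid_le h := (edist_contract_eq_zero h.adj).le
  within_of_eq h :=
    within_zero_of_reachable within_of_braidGraph_adj (SimpleGraph.ConnectedComponent.exact h)
  within_of_adj := within_one_of_contract_adj le_rfl within_of_braidGraph_adj

theorem graphsConnected (π : Equiv.Perm (Fin n)) : GraphsConnected π :=
  ⟨(measuresCost_G π).connected, (measuresCost_C π).connected, (measuresCost_B π).connected⟩

end Graphs

section Decomposition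

variable {a b n N M θ κ : ℕ}

theorem Avoids.of_embedding {k l m : ℕ} {π : Equiv.Perm (Fin m)} {σ : Equiv.Perm (Fin k)}
    {τ : Equiv.Perm (Fin l)} (h : Avoids π τ) (f : Fin k ↪o Fin m)
    (hf : ∀ i j, π (f i) ≤ π (f j) ↔ σ i ≤ σ j) : Avoids σ τ := by
  rintro ⟨e, he⟩
  exact h ⟨e.trans f, fun i j => (hf _ _).trans (he i j)⟩

theorem Avoids.of_inflate12_left {k : ℕ} {τ : Equiv.Perm (Fin k)} {α : Equiv.Perm (Fin a)}
    {β : Equiv.Perm (Fin b)} (h : Avoids (inflate12 α β) τ) : Avoids α τ :=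
  h.of_embedding (Fin.castAddOrderEmb b) (by simp [(Fin.strictMono_castAdd b).le_iff_le])

theorem Avoids.of_inflate12_right {k : ℕ} {τ : Equiv.Perm (Fin k)} {α : Equiv.Perm (Fin a)}
    {β : Equiv.Perm (Fin b)} (h : Avoids (inflate12 α β) τ) : Avoids β τ :=
  h.of_embedding (Fin.natAddOrderEmb a) (by simp)

theorem Avoids.of_insertMin {k : ℕ} {τ : Equiv.Perm (Fin k)} {z : Fin (n + 1)}
    {α : Equiv.Perm (Fin n)} (h : Avoids (insertMin z α) τ) : Avoids α τ :=
  h.of_embedding (Fin.succAboveOrderEmb z) (by simp)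

/-- Otherwise `i`, `z` and `j` would be the positions of a `312`. -/
theorem Avoids.lt_of_lt_of_lt {π : Equiv.Perm (Fin n)} (hπ : Avoids π perm312) {i z j : Fin n}
    (hi : i < z) (hj : z < j) (hz : π z < π j) : π i < π j := by
  by_contra! hij
  replace hij := hij.lt_of_ne (π.injective.ne (hi.trans hj).ne')
  have hzi := hz.trans hij
  have hmono : StrictMono ![i, z, j] := by
    simp [Fin.strictMono_iff_lt_succ, Fin.forall_fin_two, hi, hj]
  refine hπ ⟨OrderEmbedding.ofStrictMono _ hmono, fun x y => ?_⟩
  fin_cases x <;> fin_cases y <;> simp [perm312, hij.le, hz.le, hzi.le, hij, hz, hzi]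

theorem val_lt_of_forall_castAdd_lt_natAdd {π : Equiv.Perm (Fin (a + b))}
    (h : ∀ i j, π (Fin.castAdd b i) < π (Fin.natAdd a j)) (i : Fin a) :
    (π (Fin.castAdd b i) : ℕ) < a := by
  have larger : Finset.univ.map ((Fin.natAddEmb a).trans π.toEmbedding) ⊆
      Finset.Ioi (π (Fin.castAdd b i)) := by
    intro x hx
    obtain ⟨j, -, rfl⟩ := Finset.mem_map.1 hx
    exact Finset.mem_Ioi.2 (h i j)
  have := Finset.card_le_card larger
  rw [Finset.card_map, Finset.card_fin, Fin.card_Ioi] at this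
  omega

theorem exists_eq_inflate12 {π : Equiv.Perm (Fin (a + b))}
    (h : ∀ i j, π (Fin.castAdd b i) < π (Fin.natAdd a j)) :
    ∃ α β, π = inflate12 α β := by
  have hmaps : Set.MapsTo (finSumFinEquiv.symm.permCongr π)
      (Set.range Sum.inl) (Set.range Sum.inl) := by
    rintro _ ⟨i, rfl⟩
    refine ⟨⟨_, val_lt_of_forall_castAdd_lt_natAdd h i⟩, ?_⟩
    simp [Equiv.permCongr_apply, Equiv.eq_symm_apply]
  obtain ⟨⟨α, β⟩, hαβ⟩ := Equiv.Perm.mem_sumCongrHom_range_of_perm_mapsTo_inl hmaps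
  exact ⟨α, β, (finSumFinEquiv.permCongr.eq_symm_apply.1 hαβ).symm⟩

theorem inflate21_one (α : Equiv.Perm (Fin n)) :
    inflate21 α (1 : Equiv.Perm (Fin 1)) = insertMin (Fin.last n) α := by
  refine Equiv.ext (Fin.lastCases ?_ fun i => ?_)
  · rw [insertMin_self]
    simp [inflate21, Fin.ext_iff]
  · rw [← Fin.succAbove_last, insertMin_succAbove]
    simp [inflate21]

theorem exists_eq_inflate21_one {α : Equiv.Perm (Fin (n + 1))} (h : α (Fin.last n) = 0) :
    ∃ π', α = inflate21 π' (1 : Equiv.Perm (Fin 1)) := by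
  obtain ⟨π', hα⟩ := exists_eq_insertMin α
  rw [← h, Equiv.symm_apply_apply] at hα
  exact ⟨π', hα.trans (inflate21_one π').symm⟩

theorem resize_rfl (π : Equiv.Perm (Fin n)) : resize rfl π = π := rfl

theorem Avoids.exists_eq_inflate (h : a + 1 + b = n) {π : Equiv.Perm (Fin n)}
    (hπ : Avoids π perm312) {z : Fin n} (hz : (z : ℕ) = a) (hmin : ∀ i, π z ≤ π i) :
    ∃ (π' : Equiv.Perm (Fin a)) (π'' : Equiv.Perm (Fin b)),
      Avoids π' perm312 ∧ Avoids π'' perm312 ∧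
        π = resize h (inflate12 (inflate21 π' (1 : Equiv.Perm (Fin 1))) π'') := by
  subst h
  obtain rfl : z = Fin.castAdd b (Fin.last a) := Fin.ext hz
  have hlt : ∀ i j, π (Fin.castAdd b i) < π (Fin.natAdd (a + 1) j) := fun i j => by
    have hzj : π (Fin.castAdd b (Fin.last a)) < π (Fin.natAdd (a + 1) j) :=
      (hmin _).lt_of_ne (π.injective.ne (by grind))
    obtain rfl | hi := (Fin.le_last i).eq_or_lt
    · exact hzj
    · exact hπ.lt_of_lt_of_lt hi (by grind) hzj
  obtain ⟨α, π'', rfl⟩ := exists_eq_inflate12 hlt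
  have hα : α (Fin.last a) = 0 := by
    simpa [(Fin.strictMono_castAdd b).le_iff_le] using hmin (Fin.castAdd b (α.symm 0))
  obtain ⟨π', rfl⟩ := exists_eq_inflate21_one hα
  refine ⟨π', π'', ?_, hπ.of_inflate12_right, (resize_rfl _).symm⟩
  have := hπ.of_inflate12_left
  rw [inflate21_one] at this
  exact this.of_insertMin

theorem IsWordDiam.resize_inflate (h : a + 1 + b = n) {π' : Equiv.Perm (Fin a)}
    {π'' : Equiv.Perm (Fin b)} (h' : IsWordDiam θ κ π' N) (h'' : IsWordDiam θ κ π'' M) :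
    IsWordDiam θ κ (resize h (WordGraph.inflate12 (inflate21 π' (1 : Equiv.Perm (Fin 1))) π''))
      (N + (θ + κ * (a - 2)) * len π' + M + κ * ((len π' + a) * len π'')) := by
  subst h
  have hlen := len_insertMin (Fin.last a) π'
  rw [Fin.val_last] at hlen
  rw [resize_rfl, inflate21_one, ← hlen]
  exact h'.insertMin_last.inflate12 h''

/-- The truncated subtraction in `IsWordDiam.insertMin_last` does no harm, as `len π = 0` when
`n < 2`. -/
theorem cast_sub_two_mul_len (π : Equiv.Perm (Fin n)) :
    ((n - 2 : ℕ) : ℤ) * len π = (n - 2) * len π := by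
  obtain hn | hn := Nat.lt_or_ge n 2
  · have := Fin.subsingleton_iff_le_one.2 (Nat.le_of_lt_succ hn)
    have : len π ≤ 0 := len_le_length (w := []) ⟨by simp, Subsingleton.elim _ _⟩
    simp [Nat.le_zero.1 this]
  · rw [Nat.cast_sub hn, Nat.cast_ofNat]

end Decomposition

end WordGraph

open WordGraph in
theorem theorem5p3_general {a b n : ℕ} (h : a + 1 + b = n) (π' : Equiv.Perm (Fin a))
    (π'' : Equiv.Perm (Fin b)) :
    let π := resize h (inflate12 (inflate21 π' (1 : Equiv.Perm (Fin 1))) π'')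
    GraphsConnected π ∧ GraphsConnected π' ∧ GraphsConnected π'' ∧
      ((G π).diam : ℤ) = (G π').diam + (G π'').diam + (a : ℤ) * ((len π' : ℤ) + len π'')
        + (len π' : ℤ) * ((len π'' : ℤ) - 1) ∧
      (C π).diam = (C π').diam + (C π'').diam + len π' ∧
      ((B π).diam : ℤ) = (B π').diam + (B π'').diam + (a : ℤ) * ((len π' : ℤ) + len π'')
        + (len π' : ℤ) * ((len π'' : ℤ) - 2) := by
  intro π
  have diamG := (measuresCost_G π).isWordDiam.unique
    ((measuresCost_G π').isWordDiam.resize_inflate h (measuresCost_G π'').isWordDiam)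
  have diamC := (measuresCost_C π).isWordDiam.unique
    ((measuresCost_C π').isWordDiam.resize_inflate h (measuresCost_C π'').isWordDiam)
  have diamB := (measuresCost_B π).isWordDiam.unique
    ((measuresCost_B π').isWordDiam.resize_inflate h (measuresCost_B π'').isWordDiam)
  have hlen := cast_sub_two_mul_len π'
  refine ⟨graphsConnected π, graphsConnected π', graphsConnected π'', ?_, ?_, ?_⟩
  · rw [diamG]
    push_cast
    linear_combination hlen
  · rw [diamC]
    ring
  · rw [diamB]
    push_cast
    linear_combination hlen

theorem theorem5p3 (n m : ℕ) (hm1 : 1 ≤ m) (hmn : m ≤ n) (π : Equiv.Perm (Fin n))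
    (hπ : WordGraph.Avoids π WordGraph.perm312)
    (hm : π ⟨m - 1, by omega⟩ = ⟨0, by omega⟩) :
    ∃ (π' : Equiv.Perm (Fin (m - 1))) (π'' : Equiv.Perm (Fin (n - m))),
      WordGraph.Avoids π' WordGraph.perm312 ∧
      WordGraph.Avoids π'' WordGraph.perm312 ∧
      π = WordGraph.resize (by omega : (m - 1 + 1) + (n - m) = n)
        (WordGraph.inflate12
          (WordGraph.inflate21 π' (1 : Equiv.Perm (Fin 1))) π'') ∧
      WordGraph.GraphsConnected π ∧
      WordGraph.GraphsConnected π' ∧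
      WordGraph.GraphsConnected π'' ∧
      ((WordGraph.G π).diam : ℤ) =
        (WordGraph.G π').diam + (WordGraph.G π'').diam
          + ((m : ℤ) - 1) * ((WordGraph.len π' : ℤ) + WordGraph.len π'')
          + (WordGraph.len π' : ℤ) * ((WordGraph.len π'' : ℤ) - 1) ∧
      (WordGraph.C π).diam =
        (WordGraph.C π').diam + (WordGraph.C π'').diam + WordGraph.len π' ∧
      ((WordGraph.B π).diam : ℤ) =
        (WordGraph.B π').diam + (WordGraph.B π'').diam
          + ((m : ℤ) - 1) * ((WordGraph.len π' : ℤ) + WordGraph.len π'')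
          + (WordGraph.len π' : ℤ) * ((WordGraph.len π'' : ℤ) - 2) := by
  have hsize : m - 1 + 1 + (n - m) = n := by omega
  have hmin : ∀ i, π ⟨m - 1, by omega⟩ ≤ π i := fun i => hm ▸ Nat.zero_le _
  obtain ⟨π', π'', h', h'', rfl⟩ := hπ.exists_eq_inflate hsize rfl hmin
  refine ⟨π', π'', h', h'', rfl, ?_⟩
  have := theorem5p3_general hsize π' π''
  rwa [Nat.cast_sub hm1, Nat.cast_one] at this
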